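/- Let $X$ be a real or complex Banach space with a Schauder basis $(e_i)_{i\in\mathbb N}$. Definitions. The support of $x\in X$ is the set of $i$ at which its $i$-th coordinate is non-zero; a block is a non-zero vector of finite support. A (finite or infinite) block-sequence is a sequence of blocks with successive supports, and $[y]$ denotes the closed linear span of a sequence $y$. Non-empty finite block-sequences $\tilde x_0,\tilde x_1,\dots$ are successive if every term of $\tilde x_m$ has support strictly before that of every term of $\tilde x_n$ whenever $m<n$. A sequence $(y_i)$ passes through $\tilde x=(x_1,\dots,x_n)$ if for some integer $m$ one has $y_{m+i}=x_i$ for all $1\le i\le n$. Two spaces are $K$-isomorphic if there is a linear isomorphism $T$ of one onto the other with $\|T\|\,\|T^{-1}\|\le K$. $E_0$ is the relation of eventual agreement on $2^{\mathbb N}$. $X$ is ergodic if there is a Borel map $f$ from $2^{\mathbb N}$ to the set of closed linear subspaces of $X$, with its Effros-Borel structure, such that $\alpha E_0\beta$ if and only if $f(\alpha)$ and $f(\beta)$ are linearly isomorphic. Let $\mathbf Q$ be the (countable) set of vectors $r/\|r\|$, where $r$ is a block with coordinates in $\mathbb Q$ (in $\mathbb Q+i\mathbb Q$ in the complex case), and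 let $bb_d(X)$ be the space of infinite block-sequences with terms in $\mathbf Q$, with the product of the discrete topologies on $\mathbf Q$. For $\mathcal A\subset bb_d(X)$ and $\Delta=(\delta_n)$, let $\mathcal A_\Delta$ be the set of $x\in bb_d(X)$ such that some $y\in\mathcal A$ satisfies $\|y_n-x_n\|\le\delta_n$ for all $n$. A set is residual if it is comeagre. Theorem. (1) Either $X$ is ergodic, or there exist $K\ge1$ and a sequence $(\tilde x_n)$ of successive finite block-sequences of normalized vectors such that all infinite block-sequences passing through infinitely many of the $\tilde x_n$ span mutually $K$-isomorphic subspaces. (2) Either $X$ is ergodic, or there exist $K\ge1$ and a residual subset of $bb_d(X)$ whose elements span mutually $K$-isomorphic subspaces. (3) Let $\mathcal A$ be residual in $bb_d(X)$ and let $\Delta=(\delta_n)$ be a sequence of positive reals. Then there are successive finite block-sequences $(\tilde x_n)$ with terms in $\mathbf Q$ such that every element of $bb_d(X)$ passing through infinitely many of the $\tilde x_n$ is in $\mathcal A_\Delta$. (4) Conversely, for any successive finite block-sequences $(\tilde x_n)$ with terms in $\mathbf Q$, the set of elements of $bb_d(X)$ passing through infinitely many of the $\tilde x_n$ is residual in $bb_d(X)$.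 (5) Let $x\in bb_d(X)$ and let $\mathcal A$ be the set of $y\in bb_d(X)$ with $[y]$ isomorphic to $[x]$. Then $\mathcal A$ is residual in $bb_d(X)$ if and only if there are successive finite block-sequences $(\tilde x_n)$ with terms in $\mathbf Q$ such that every element of $bb_d(X)$ passing through infinitely many of the $\tilde x_n$ is in $\mathcal A$. -/

import Mathlib

namespace ErgodicBanach

noncomputable section

open Set

/-! ### Borel reducibility, the Effros-Borel structure, ergodic spaces -/

/-- Eventual agreement of infinite binary sequences. -/
def E0 (α β : ℕ → Bool) : Prop := ∃ n, ∀ m, n ≤ m → α m = β m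

/-- The relation `E` on `S` Borel reduces to the relation `F` on `T`. -/
def BorelReduces {S T : Type*} [MeasurableSpace S] [MeasurableSpace T]
    (E : S → S → Prop) (F : T → T → Prop) : Prop :=
  ∃ f : S → T, Measurable f ∧ ∀ s s', E s s' ↔ F (f s) (f s')

/-- The Effros-Borel structure on the set of closed linear subspaces of `X`: it is generated by
the sets `{F | F ∩ U ≠ ∅}` with `U` open in `X`. -/
abbrev effrosBorel (𝕜 X : Type*) [RCLike 𝕜] [NormedAddCommGroup X] [NormedSpace 𝕜 X] :
    MeasurableSpace (ClosedSubmodule 𝕜 X) :=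
  MeasurableSpace.generateFrom
    {S | ∃ U : Set X, IsOpen U ∧ S = {F : ClosedSubmodule 𝕜 X | ((F : Set X) ∩ U).Nonempty}}

/-- Linear isomorphism (linear homeomorphism) of subspaces. -/
def Isomorphic {𝕜 X : Type*} [RCLike 𝕜] [NormedAddCommGroup X] [NormedSpace 𝕜 X]
    (Y Z : Submodule 𝕜 X) : Prop :=
  Nonempty (Y ≃L[𝕜] Z)

/-- `K`-isomorphism of subspaces. -/
def KIsomorphic {𝕜 X : Type*} [RCLike 𝕜] [NormedAddCommGroup X] [NormedSpace 𝕜 X]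
    (K : ℝ) (Y Z : Submodule 𝕜 X) : Prop :=
  ∃ T : Y ≃L[𝕜] Z, ‖(T : Y →L[𝕜] Z)‖ * ‖(T.symm : Z →L[𝕜] Y)‖ ≤ K

/-- `X` is ergodic: `E0` on the Cantor space Borel reduces to isomorphism between closed linear
subspaces of `X`. -/
def IsErgodic (𝕜 X : Type*) [RCLike 𝕜] [NormedAddCommGroup X] [NormedSpace 𝕜 X] : Prop :=
  @BorelReduces (ℕ → Bool) (ClosedSubmodule 𝕜 X) (borel (ℕ → Bool)) (effrosBorel 𝕜 X)
    E0 (fun F G => Isomorphic F.toSubmodule G.toSubmodule)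

/-! ### Block-sequences -/

section Blocks

variable {𝕜 X : Type*} [RCLike 𝕜] [NormedAddCommGroup X] [NormedSpace 𝕜 X]

/-- The support of a vector on the basis. -/
def supp (b : SchauderBasis 𝕜 X) (x : X) : Set ℕ := {i | b.coord i x ≠ 0}

/-- A block: a nonzero finitely supported vector. -/
def IsBlock (b : SchauderBasis 𝕜 X) (x : X) : Prop := x ≠ 0 ∧ (supp b x).Finite

/-- `supp x < supp y`. -/
def SuppLT (b : SchauderBasis 𝕜 X) (x y : X) : Prop := ∀ i ∈ supp b x, ∀ j ∈ supp b y, i < j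

/-- Infinite block-sequences. -/
def IsBlockSeq (b : SchauderBasis 𝕜 X) (y : ℕ → X) : Prop :=
  (∀ n, IsBlock b (y n)) ∧ ∀ m n, m < n → SuppLT b (y m) (y n)

/-- Finite block-sequences. -/
def IsFinBlockSeq (b : SchauderBasis 𝕜 X) (l : List X) : Prop :=
  (∀ x ∈ l, IsBlock b x) ∧ l.Pairwise (SuppLT b)

/-- A sequence of successive nonempty finite block-sequences. -/
def IsSuccessive (b : SchauderBasis 𝕜 X) (u : ℕ → List X) : Prop :=
  (∀ n, u n ≠ [] ∧ IsFinBlockSeq b (u n)) ∧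
    ∀ m n, m < n → ∀ x ∈ u m, ∀ y ∈ u n, SuppLT b x y

/-- The closed linear span `[y]` of a sequence. -/
def closedSpan (𝕜 : Type*) {X : Type*} [RCLike 𝕜] [NormedAddCommGroup X] [NormedSpace 𝕜 X]
    (y : ℕ → X) : Submodule 𝕜 X :=
  (Submodule.span 𝕜 (range y)).topologicalClosure

/-- The sequence `y` passes through the finite sequence `l`. -/
def PassesThrough {X : Type*} (y : ℕ → X) (l : List X) : Prop :=
  ∃ m : ℕ, ∀ (i : ℕ) (hi : i < l.length), y (m + i) = l[i]

/-- The sequence `y` passes through infinitely many of the `u n`. -/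
def PassesThroughInf {X : Type*} (y : ℕ → X) (u : ℕ → List X) : Prop :=
  {n | PassesThrough y (u n)}.Infinite

/-! ### The space of normalized block-sequences of rational direction -/

/-- Rational scalars: `ℚ` in the real case, `ℚ + iℚ` in the complex case
(for `𝕜 = ℝ`, `RCLike.I = 0`). -/
def IsRatScalar (a : 𝕜) : Prop := ∃ p q : ℚ, a = (p : 𝕜) + (q : 𝕜) * RCLike.I

/-- The set `Q` of normalizations of blocks with rational coordinates. -/
def ratBlocks (b : SchauderBasis 𝕜 X) : Set X :=
  {x | ∃ r : X, IsBlock b r ∧ (∀ i, IsRatScalar (b.coord i r)) ∧ x = ((‖r‖⁻¹ : ℝ) : 𝕜) • r}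

/-- The set `Q` as a type, carrying the discrete topology (not the norm topology). -/
def RatBlock (b : SchauderBasis 𝕜 X) : Type _ := {x : X // x ∈ ratBlocks b}

instance instTopologicalSpaceRatBlock (b : SchauderBasis 𝕜 X) :
    TopologicalSpace (RatBlock b) := ⊥

instance instDiscreteTopologyRatBlock (b : SchauderBasis 𝕜 X) :
    DiscreteTopology (RatBlock b) := ⟨rfl⟩

/-- The space `bb_d(X)` of block-sequences of vectors of `Q`, with the topology induced by the
product of the discrete topologies. -/
abbrev BBd (b : SchauderBasis 𝕜 X) : Type _ :=
  {y : ℕ → RatBlock b // IsBlockSeq b (fun n => (y n).1)}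

/-- The underlying sequence of vectors of an element of `bb_d(X)`. -/
def BBd.seq {b : SchauderBasis 𝕜 X} (y : BBd b) : ℕ → X := fun n => (y.1 n).1

/-- The `Δ`-expansion of a subset of `bb_d(X)`. -/
def expansion {b : SchauderBasis 𝕜 X} (A : Set (BBd b)) (Δ : ℕ → ℝ) : Set (BBd b) :=
  {x | ∃ y ∈ A, ∀ n, ‖y.seq n - x.seq n‖ ≤ Δ n}

/-- The isomorphism class of `x` in `bb_d(X)`. -/
def isoClass {b : SchauderBasis 𝕜 X} (x : BBd b) : Set (BBd b) :=
  {y | Isomorphic (closedSpan 𝕜 y.seq) (closedSpan 𝕜 x.seq)}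

end Blocks

end

end ErgodicBanach

/-! Let E be the set of pairs (x, y) of elements of bb_d(X) with [x] and [y] isomorphic. It is the
union over natural numbers C of analytic sets E_C, the projections of `isoWitness`: pairs with an
isomorphism bounded by C in both directions.

If every E_C is meagre, so is E. A tree construction (`exists_continuous_E0`) then yields a
continuous map from the Cantor space to bb_d(X) which sends E0-inequivalent points to pairs outside
E and E0-equivalent points to sequences that eventually agree. Changing finitely many terms of a
block-sequence does not change the isomorphism type of its span, so X is ergodic.

Otherwise some E_C is comeagre in a nonempty open set, because non-meagre analytic sets are. By
Kuratowski–Ulam there are an x and a finite block-sequence s such that almost every y starting with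
s satisfies (x, y) ∈ E_C. A continuous open map that replaces the beginning of an arbitrary sequence
by s (`exists_openMap_cyl`) spreads this to almost every y in bb_d(X). The number of terms changed
is fixed, and normalized block-sequences have uniformly bounded biorthogonal functionals, so the
constants stay uniform; this gives (2).

For (3), the blocks must force membership in dense open sets whatever precedes them. One finite
block-sequence can do this for finitely many beginnings only (`exists_simultaneous_extension`), and
finite nets of blocks reduce all beginnings to finitely many, at the price of Δ. Statement (4) is a
direct density argument. Small perturbations of normalized block-sequences preserve the span up to
2-bounded isomorphism, which turns (2) and (3) into (1), and (3) and (4) into (5). -/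

namespace ErgodicBanach

noncomputable section

open Set Filter Topology

/-! ### Baire category -/

section Category

/-- A residual set contains the intersection of a decreasing sequence of dense open sets. -/
theorem exists_antitone_dense_open {Z : Type*} [TopologicalSpace Z] {R : Set Z}
    (hR : R ∈ residual Z) :
    ∃ D : ℕ → Set Z, Antitone D ∧ (∀ n, IsOpen (D n)) ∧ (∀ n, Dense (D n)) ∧ ⋂ n, D n ⊆ R := by
  obtain ⟨S, ho, hd, hc, hS⟩ := mem_residual_iff.1 hR
  -- Adding `univ` makes the countable family nonempty, so that it can be enumerated.
  obtain ⟨g, hg⟩ := (hc.insert univ).exists_eq_range (insert_nonempty _ _)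
  have ho' : ∀ n, IsOpen (g n) := fun n => by
    rcases (hg ▸ mem_range_self n : g n ∈ insert univ S) with h | h
    · simp [h]
    · exact ho _ h
  have hd' : ∀ n, Dense (g n) := fun n => by
    rcases (hg ▸ mem_range_self n : g n ∈ insert univ S) with h | h
    · simp [h, dense_univ]
    · exact hd _ h
  have key : ∀ n, IsOpen (⋂ i ∈ Finset.range n, g i) ∧ Dense (⋂ i ∈ Finset.range n, g i) := by
    intro n
    induction n with
    | zero => simp [dense_univ]
    | succ n ih =>
      rw [Finset.range_add_one, Finset.set_biInter_insert]
      exact ⟨(ho' n).inter ih.1, (hd' n).inter_of_isOpen_left ih.2 (ho' n)⟩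
  refine ⟨fun n => ⋂ i ∈ Finset.range n, g i, ?_, fun n => (key n).1, fun n => (key n).2, ?_⟩
  · intro m n hmn
    exact biInter_subset_biInter_left (by simpa using hmn)
  · refine Subset.trans (fun z hz => ?_) hS
    rw [mem_sInter]
    intro t ht
    obtain ⟨n, rfl⟩ : t ∈ range g := hg ▸ mem_insert_of_mem _ ht
    exact mem_iInter₂.1 (mem_iInter.1 hz (n + 1)) n (by simp)

/-- One direction of the Kuratowski–Ulam theorem. -/
theorem eventually_residual_section {Y Z : Type*} [TopologicalSpace Y] [TopologicalSpace Z]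
    [SecondCountableTopology Z] {R : Set (Y × Z)} (hR : R ∈ residual (Y × Z)) :
    ∀ᶠ y in residual Y, ∀ᶠ z in residual Z, (y, z) ∈ R := by
  obtain ⟨D, -, ho, hd, hD⟩ := exists_antitone_dense_open hR
  have hB := TopologicalSpace.isBasis_countableBasis Z
  have key : ∀ n, ∀ᶠ y in residual Y, {z | (y, z) ∈ D n} ∈ residual Z := by
    intro n
    -- The points whose section meets a given basic open set form a dense open set; a section
    -- meeting all of them is dense.
    have h1 : ∀ B ∈ TopologicalSpace.countableBasis Z,
        ∀ᶠ y in residual Y, ∃ z ∈ B, (y, z) ∈ D n := by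
      intro B hBm
      have hBo := TopologicalSpace.isOpen_of_mem_countableBasis hBm
      have hBn := TopologicalSpace.nonempty_of_mem_countableBasis hBm
      have heq : {y | ∃ z ∈ B, (y, z) ∈ D n} = Prod.fst '' (D n ∩ univ ×ˢ B) := by
        ext y
        constructor
        · rintro ⟨z, hz, h⟩
          exact ⟨(y, z), ⟨h, trivial, hz⟩, rfl⟩
        · rintro ⟨⟨y, z⟩, ⟨h, -, hz⟩, rfl⟩
          exact ⟨z, hz, h⟩
      refine residual_of_dense_open ?_ ?_
      · rw [heq]
        exact isOpenMap_fst _ ((ho n).inter (isOpen_univ.prod hBo))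
      · rw [dense_iff_inter_open]
        intro V hV hVn
        obtain ⟨⟨y, z⟩, ⟨hy, hz⟩, h⟩ :=
          (hd n).inter_open_nonempty _ (hV.prod hBo) (hVn.prod hBn)
        exact ⟨y, hy, z, hz, h⟩
    have h2 := (eventually_countable_ball (TopologicalSpace.countable_countableBasis Z)).2 h1
    filter_upwards [h2] with y hy
    refine residual_of_dense_open ((ho n).preimage (by fun_prop)) ?_
    rw [hB.dense_iff]
    intro B hBm _
    exact hy B hBm
  filter_upwards [eventually_countable_forall.2 key] with y hy
  have := countable_iInter_mem.2 hy
  filter_upwards [this] with z hz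
  exact hD (mem_iInter.2 fun n => mem_iInter.1 hz n)

/-! ### Analytic sets modulo meagre sets. -/

variable {Z : Type*} [TopologicalSpace Z]

/-- The largest open set in which `B` is meagre. -/
def meagrePart (B : Set Z) : Set Z := ⋃₀ {V | IsOpen V ∧ IsMeagre (B ∩ V)}

theorem isOpen_meagrePart (B : Set Z) : IsOpen (meagrePart B) := isOpen_sUnion fun _ h => h.1

theorem isMeagre_inter_meagrePart [SecondCountableTopology Z] (B : Set Z) :
    IsMeagre (B ∩ meagrePart B) := by
  obtain ⟨T, hT, hTS, hU⟩ := TopologicalSpace.isOpen_sUnion_countable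
    {V | IsOpen V ∧ IsMeagre (B ∩ V)} fun _ h => h.1
  rw [meagrePart, ← hU, sUnion_eq_biUnion, inter_iUnion₂]
  exact isMeagre_biUnion hT fun V hV => (hTS hV).2

/-- A closed set containing `B` up to a meagre set, minimal up to meagre sets. -/
def closedHull (B : Set Z) : Set Z := closure B \ meagrePart B

theorem isClosed_closedHull (B : Set Z) : IsClosed (closedHull B) :=
  isClosed_closure.sdiff (isOpen_meagrePart B)

theorem isMeagre_diff_closedHull [SecondCountableTopology Z] (B : Set Z) :
    IsMeagre (B \ closedHull B) := by
  refine (isMeagre_inter_meagrePart B).mono ?_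
  intro x hx
  refine ⟨hx.1, ?_⟩
  by_contra h
  exact hx.2 ⟨subset_closure hx.1, h⟩

/-- The difference W equals an open set u up to a meagre set. Almost no point of any `B n` lies in
W, so the union is meagre in u. Hence u lies in the meagre part removed from the hull, W misses u,
and W is meagre. -/
theorem isMeagre_closedHull_diff_iUnion [SecondCountableTopology Z] (B : ℕ → Set Z) :
    IsMeagre (closedHull (⋃ n, B n) \ ⋃ n, closedHull (B n)) := by
  set W := closedHull (⋃ n, B n) \ ⋃ n, closedHull (B n) with hW
  have hWm : BaireMeasurableSet W :=
    (isClosed_closedHull _).isOpen_compl.baireMeasurableSet.of_compl.diff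
      (BaireMeasurableSet.iUnion fun n =>
        (isClosed_closedHull _).isOpen_compl.baireMeasurableSet.of_compl)
  obtain ⟨u, hu, hWu⟩ := hWm.residualEq_isOpen
  have h1 : IsMeagre (u \ W) := by
    filter_upwards [hWu] with x hx h
    exact h.2 (hx.mpr h.1)
  have h2 : IsMeagre (W \ u) := by
    filter_upwards [hWu] with x hx h
    exact h.2 (hx.mp h.1)
  have h3 : IsMeagre ((⋃ n, B n) ∩ u) := by
    refine (h1.union (isMeagre_iUnion fun n => isMeagre_diff_closedHull (B n))).mono ?_
    rintro x ⟨hx, hxu⟩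
    obtain ⟨n, hn⟩ := mem_iUnion.1 hx
    by_cases h : x ∈ closedHull (B n)
    · exact Or.inl ⟨hxu, fun hxW => hxW.2 (mem_iUnion.2 ⟨n, h⟩)⟩
    · exact Or.inr (mem_iUnion.2 ⟨n, hn, h⟩)
  refine h2.mono ?_
  intro x hx
  exact ⟨hx, fun hxu => hx.1.2 (mem_sUnion.2 ⟨u, ⟨hu, h3⟩, hxu⟩)⟩

/-- Let `A s` be the image of the sequences starting with s. Outside the countably many meagre sets
of the previous lemma, a point in the hull of `A s` is in the hull of some `A (s ++ [n])`. Iterating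
yields a branch σ, and continuity forces the point to be `f σ`. -/
theorem isMeagre_closedHull_range_diff {f : (ℕ → ℕ) → Z} [SecondCountableTopology Z] [T3Space Z]
    (hf : Continuous f) : IsMeagre (closedHull (range f) \ range f) := by
  let A : List ℕ → Set Z := fun s => f '' {τ | (List.range s.length).map τ = s}
  have hA : ∀ s, A s = ⋃ n, A (s ++ [n]) := by
    intro s
    ext z
    simp only [A, mem_iUnion, mem_image, mem_ofPred_eq, List.length_append, List.length_cons,
      List.length_nil, zero_add, List.range_succ, List.map_append, List.map_cons, List.map_nil]
    constructor
    · rintro ⟨τ, h, rfl⟩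
      exact ⟨τ s.length, τ, by rw [h], rfl⟩
    · rintro ⟨n, τ, h, rfl⟩
      exact ⟨τ, (List.append_inj' h rfl).1, rfl⟩
  have hA0 : A [] = range f := by simp [A]
  have hM : ∀ s, IsMeagre (closedHull (A s) \ ⋃ n, closedHull (A (s ++ [n]))) := by
    intro s
    conv => enter [1, 1]; rw [hA s]
    exact isMeagre_closedHull_diff_iUnion _
  refine (isMeagre_iUnion hM).mono ?_
  rintro x ⟨hx, hxr⟩
  by_contra hcon
  have hstep : ∀ s : {s // x ∈ closedHull (A s)}, ∃ n, x ∈ closedHull (A (s.1 ++ [n])) := by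
    rintro ⟨s, hs⟩
    by_contra h
    exact hcon (mem_iUnion.2 ⟨s, hs, fun h' => h (mem_iUnion.1 h')⟩)
  choose c hc using hstep
  let l : ℕ → {s // x ∈ closedHull (A s)} := fun n =>
    Nat.rec ⟨[], hA0 ▸ hx⟩ (fun _ s => ⟨s.1 ++ [c s], hc s⟩) n
  have hl : ∀ n, (l n).1 = (List.range n).map fun i => c (l i) := by
    intro n
    induction n with
    | zero => rfl
    | succ n ih =>
      rw [List.range_succ, List.map_append, ← ih]
      rfl
  set σ : ℕ → ℕ := fun i => c (l i) with hσ
  apply hxr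
  refine ⟨σ, ?_⟩
  by_contra hne
  -- A closed neighbourhood C of `f σ` missing x: by continuity it contains `A (l n)` for large n,
  -- while x is in the closure of that set.
  obtain ⟨C, ⟨hC, hCc⟩, hxC⟩ := (closed_nhds_basis (f σ)).mem_iff.1
    (isOpen_compl_singleton.mem_nhds (show f σ ∈ ({x} : Set Z)ᶜ from hne))
  have hpre : f ⁻¹' C ∈ 𝓝 σ := hf.continuousAt.preimage_mem_nhds hC
  obtain ⟨O, hOC, hO, hσO⟩ := mem_nhds_iff.1 hpre
  obtain ⟨I, u, hu, hIu⟩ := isOpen_pi_iff.1 hO σ hσO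
  let n := I.sup id + 1
  have hsub : A (l n).1 ⊆ C := by
    rintro _ ⟨τ, hτ, rfl⟩
    apply hOC
    apply hIu
    intro i hi
    have hin : i < n := Nat.lt_succ_of_le (Finset.le_sup (f := id) hi)
    have : τ i = σ i := by
      have h := hτ
      simp only [mem_ofPred_eq, hl n, List.length_map, List.length_range] at h
      exact List.map_inj_left.1 h i (by simpa using hin)
    rw [this]
    exact (hu i hi).2
  exact hxC (closure_minimal hsub hCc (l n).2.1) rfl

/-- An analytic set is meagre, or comeagre in a nonempty open set. -/
theorem isMeagre_or_comeagre_in_open_of_analyticSet [SecondCountableTopology Z] [T3Space Z]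
    {A : Set Z} (hA : MeasureTheory.AnalyticSet A) :
    IsMeagre A ∨ ∃ V : Set Z, IsOpen V ∧ V.Nonempty ∧ IsMeagre (V \ A) := by
  rw [MeasureTheory.AnalyticSet] at hA
  rcases hA with rfl | ⟨f, hf, rfl⟩
  · exact Or.inl .empty
  rcases (interior (closedHull (range f))).eq_empty_or_nonempty with h | h
  · left
    have : IsNowhereDense (closedHull (range f)) := by
      rwa [IsNowhereDense, (isClosed_closedHull _).closure_eq]
    refine (this.isMeagre.union (isMeagre_diff_closedHull (range f))).mono fun x hx => ?_
    by_cases hx' : x ∈ closedHull (range f)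
    · exact Or.inl hx'
    · exact Or.inr ⟨hx, hx'⟩
  · exact Or.inr ⟨_, isOpen_interior, h,
      (isMeagre_closedHull_range_diff hf).mono (sdiff_subset_sdiff_left interior_subset)⟩

end Category

/-! ### Isomorphisms between closed spans -/

section Spaces

variable {𝕜 X : Type*} [RCLike 𝕜] [NormedAddCommGroup X] [NormedSpace 𝕜 X]

/-- There is a linear isomorphism which is `K`-bounded together with its inverse. -/
def BddIso (K : ℝ) (Y Z : Submodule 𝕜 X) : Prop :=
  ∃ T : Y ≃L[𝕜] Z, ‖(T : Y →L[𝕜] Z)‖ ≤ K ∧ ‖(T.symm : Z →L[𝕜] Y)‖ ≤ K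

theorem BddIso.nonneg {K : ℝ} {Y Z : Submodule 𝕜 X} (h : BddIso K Y Z) : 0 ≤ K := by
  obtain ⟨T, h, -⟩ := h
  exact (norm_nonneg _).trans h

theorem BddIso.isomorphic {K : ℝ} {Y Z : Submodule 𝕜 X} (h : BddIso K Y Z) : Isomorphic Y Z :=
  ⟨h.choose⟩

theorem BddIso.kIsomorphic {K : ℝ} {Y Z : Submodule 𝕜 X} (h : BddIso K Y Z) :
    KIsomorphic (K * K) Y Z := by
  have hK := h.nonneg
  obtain ⟨T, h1, h2⟩ := h
  exact ⟨T, mul_le_mul h1 h2 (norm_nonneg _) hK⟩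

theorem BddIso.symm {K : ℝ} {Y Z : Submodule 𝕜 X} (h : BddIso K Y Z) : BddIso K Z Y := by
  obtain ⟨T, h1, h2⟩ := h
  exact ⟨T.symm, h2, h1⟩

theorem BddIso.trans {K L : ℝ} {Y Z W : Submodule 𝕜 X} (h : BddIso K Y Z) (h' : BddIso L Z W) :
    BddIso (K * L) Y W := by
  have hK := h.nonneg
  have hL := h'.nonneg
  obtain ⟨T, h1, h2⟩ := h
  obtain ⟨S, h3, h4⟩ := h'
  refine ⟨T.trans S, ?_, ?_⟩
  · calc ‖((S : Z →L[𝕜] W).comp (T : Y →L[𝕜] Z))‖ ≤ _ := ContinuousLinearMap.opNorm_comp_le _ _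
      _ ≤ L * K := mul_le_mul h3 h1 (norm_nonneg _) hL
      _ = K * L := mul_comm _ _
  · calc ‖((T.symm : Z →L[𝕜] Y).comp (S.symm : W →L[𝕜] Z))‖ ≤ _ :=
        ContinuousLinearMap.opNorm_comp_le _ _
      _ ≤ K * L := mul_le_mul h2 h4 (norm_nonneg _) hK

theorem Isomorphic.trans {Y Z W : Submodule 𝕜 X} (h : Isomorphic Y Z) (h' : Isomorphic Z W) :
    Isomorphic Y W := by
  obtain ⟨T⟩ := h
  obtain ⟨S⟩ := h'
  exact ⟨T.trans S⟩

theorem bddIso_of_inverse {K : ℝ} {Y Z : Submodule 𝕜 X} (T : Y →L[𝕜] Z) (S : Z →L[𝕜] Y)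
    (hST : ∀ y, S (T y) = y) (hTS : ∀ z, T (S z) = z) (hT : ‖T‖ ≤ K) (hS : ‖S‖ ≤ K) :
    BddIso K Y Z :=
  ⟨ContinuousLinearEquiv.equivOfInverse T S hST hTS, hT, hS⟩

theorem mem_closedSpan (y : ℕ → X) (n : ℕ) : y n ∈ closedSpan 𝕜 y :=
  Submodule.le_topologicalClosure _ (Submodule.subset_span (mem_range_self n))

theorem isClosed_closedSpan (y : ℕ → X) : IsClosed (closedSpan 𝕜 y : Set X) :=
  Submodule.isClosed_topologicalClosure _

theorem closedSpan_le {y : ℕ → X} {Z : Submodule 𝕜 X} (hZ : IsClosed (Z : Set X))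
    (h : ∀ n, y n ∈ Z) : closedSpan 𝕜 y ≤ Z :=
  Submodule.topologicalClosure_minimal _ (Submodule.span_le.2 (range_subset_iff.2 h)) hZ

theorem map_mem_of_mem_closedSpan {y : ℕ → X} {Z : Submodule 𝕜 X} (hZ : IsClosed (Z : Set X))
    (T : X →L[𝕜] X) (h : ∀ n, T (y n) ∈ Z) {v : X} (hv : v ∈ closedSpan 𝕜 y) : T v ∈ Z :=
  closedSpan_le (Z := Z.comap (T : X →ₗ[𝕜] X)) (hZ.preimage T.continuous) h hv

/-- A bounded operator on a closed span is determined by its values at the generators. -/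
theorem closedSpan_induction {y : ℕ → X} {V : Type*} [NormedAddCommGroup V] [NormedSpace 𝕜 V]
    (A B : closedSpan 𝕜 y →L[𝕜] V)
    (h : ∀ n, A ⟨y n, mem_closedSpan y n⟩ = B ⟨y n, mem_closedSpan y n⟩) : A = B := by
  have key : closedSpan 𝕜 y ≤
      (LinearMap.ker ((A - B : closedSpan 𝕜 y →L[𝕜] V) : closedSpan 𝕜 y →ₗ[𝕜] V)).map
        (closedSpan 𝕜 y).subtype := by
    refine closedSpan_le ?_ ?_
    · rw [Submodule.map_coe]
      exact (isClosed_closedSpan y).isClosedEmbedding_subtypeVal.isClosedMap _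
        (ContinuousLinearMap.isClosed_ker (A - B))
    · intro n
      exact ⟨⟨y n, mem_closedSpan y n⟩, by simp [h n], rfl⟩
  ext v
  obtain ⟨w, hw, hwv⟩ := key v.2
  have : w = v := Subtype.ext hwv
  subst this
  exact sub_eq_zero.1 (by simpa using hw)

/-- Neither operator need be invertible on X: both compositions fix the generators, hence are the
identity on the closed spans. -/
theorem bddIso_of_maps {y z : ℕ → X} {K : ℝ} (T S : X →L[𝕜] X) (hT : ∀ n, T (y n) = z n)
    (hS : ∀ n, S (z n) = y n) (hTK : ‖T‖ ≤ K) (hSK : ‖S‖ ≤ K) :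
    BddIso K (closedSpan 𝕜 y) (closedSpan 𝕜 z) := by
  have hK : 0 ≤ K := (norm_nonneg _).trans hTK
  have hTm : ∀ v : closedSpan 𝕜 y, (T.comp (closedSpan 𝕜 y).subtypeL) v ∈ closedSpan 𝕜 z :=
    fun v => map_mem_of_mem_closedSpan (isClosed_closedSpan z) T
      (fun n => hT n ▸ mem_closedSpan z n) v.2
  have hSm : ∀ v : closedSpan 𝕜 z, (S.comp (closedSpan 𝕜 z).subtypeL) v ∈ closedSpan 𝕜 y :=
    fun v => map_mem_of_mem_closedSpan (isClosed_closedSpan y) S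
      (fun n => hS n ▸ mem_closedSpan y n) v.2
  let T' := (T.comp (closedSpan 𝕜 y).subtypeL).codRestrict _ hTm
  let S' := (S.comp (closedSpan 𝕜 z).subtypeL).codRestrict _ hSm
  refine bddIso_of_inverse T' S' ?_ ?_ ?_ ?_
  · have : S'.comp T' = .id 𝕜 _ :=
      closedSpan_induction _ _ fun n => Subtype.ext (by simp [T', S', hT, hS])
    exact fun v => congrArg (fun A : closedSpan 𝕜 y →L[𝕜] closedSpan 𝕜 y => A v) this
  · have : T'.comp S' = .id 𝕜 _ :=
      closedSpan_induction _ _ fun n => Subtype.ext (by simp [T', S', hT, hS])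
    exact fun v => congrArg (fun A : closedSpan 𝕜 z →L[𝕜] closedSpan 𝕜 z => A v) this
  · exact ContinuousLinearMap.opNorm_le_bound _ hK fun v => (T.le_opNorm v).trans (by gcongr; rfl)
  · exact ContinuousLinearMap.opNorm_le_bound _ hK fun v => (S.le_opNorm v).trans (by gcongr; rfl)

/-- Sequences with comparable norms of linear combinations have isomorphic closed spans. -/
theorem bddIso_of_norm_linearCombination_le [CompleteSpace X] {x w : ℕ → X} {C : ℝ} (hC : 0 ≤ C)
    (h₁ : ∀ a, ‖Finsupp.linearCombination 𝕜 w a‖ ≤ C * ‖Finsupp.linearCombination 𝕜 x a‖)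
    (h₂ : ∀ a, ‖Finsupp.linearCombination 𝕜 x a‖ ≤ C * ‖Finsupp.linearCombination 𝕜 w a‖) :
    BddIso C (closedSpan 𝕜 x) (closedSpan 𝕜 w) := by
  have hmem : ∀ (v : ℕ → X) (a : ℕ →₀ 𝕜),
      Finsupp.linearCombination 𝕜 v a ∈ closedSpan 𝕜 v := fun v a =>
    Submodule.le_topologicalClosure _
      ((Finsupp.mem_span_range_iff_exists_finsupp).2 ⟨a, rfl⟩)
  let e : ∀ v : ℕ → X, (ℕ →₀ 𝕜) →ₗ[𝕜] closedSpan 𝕜 v := fun v =>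
    (Finsupp.linearCombination 𝕜 v).codRestrict _ (hmem v)
  have hd : ∀ v, DenseRange (e v) := by
    intro v
    rintro ⟨z, hz⟩
    rw [Topology.IsInducing.subtypeVal.closure_eq_preimage_closure_image]
    have hz' : z ∈ closure (Submodule.span 𝕜 (range v) : Set X) := hz
    refine closure_mono ?_ hz'
    intro u hu
    obtain ⟨a, ha⟩ := Finsupp.mem_span_range_iff_exists_finsupp.1 hu
    exact ⟨e v a, ⟨a, rfl⟩, ha⟩
  have : ∀ v : ℕ → X, CompleteSpace (closedSpan 𝕜 v) := fun v =>
    (isClosed_closedSpan v).completeSpace_coe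
  -- The identity on finite families of coefficients extends to the closed spans; the two bounds
  -- make this well defined even for linearly dependent vectors.
  refine ⟨(LinearEquiv.refl 𝕜 (ℕ →₀ 𝕜)).extend (e x) (e w) (hd x) ⟨C, h₁⟩ (hd w) ⟨C, h₂⟩, ?_, ?_⟩
  · exact ContinuousLinearMap.opNorm_le_bound _ hC
      (LinearEquiv.norm_extend_le (.refl 𝕜 (ℕ →₀ 𝕜)) (e x) (e w) C (hd x) h₁ (hd w) ⟨C, h₂⟩)
  · exact ContinuousLinearMap.opNorm_le_bound _ hC
      (LinearEquiv.norm_extend_symm_le (.refl 𝕜 (ℕ →₀ 𝕜)) (e x) (e w) C (hd x) ⟨C, h₁⟩ (hd w) h₂)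

end Spaces

/-! ### Block-sequences: biorthogonal functionals, perturbations -/

section BlockSpaces

variable {𝕜 X : Type*} [RCLike 𝕜] [NormedAddCommGroup X] [NormedSpace 𝕜 X]

theorem proj_eq_zero_of_supp {b : SchauderBasis 𝕜 X} {x : X} {n : ℕ}
    (h : ∀ i ∈ supp b x, n ≤ i) : b.proj n x = 0 := by
  rw [SchauderBasis.proj_apply]
  refine Finset.sum_eq_zero fun i hi => ?_
  have : b.coord i x = 0 := by
    by_contra hc
    exact absurd (h i hc) (by simpa using hi)
  rw [this, zero_smul]

theorem proj_eq_self_of_supp {b : SchauderBasis 𝕜 X} {x : X} {n : ℕ}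
    (h : ∀ i ∈ supp b x, i < n) : b.proj n x = x := by
  refine tendsto_nhds_unique (tendsto_const_nhds.congr' ?_) (b.tendsto_proj x)
  filter_upwards [eventually_ge_atTop n] with m hm
  rw [SchauderBasis.proj_apply, SchauderBasis.proj_apply]
  refine Finset.sum_subset (by simpa using hm) fun i _ hi => ?_
  have : b.coord i x = 0 := by
    by_contra hc
    exact hi (by simpa using h i hc)
  rw [this, zero_smul]

theorem IsBlock.supp_nonempty {b : SchauderBasis 𝕜 X} {x : X} (h : IsBlock b x) :
    (supp b x).Nonempty := by
  by_contra hn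
  rw [not_nonempty_iff_eq_empty] at hn
  refine h.1 ?_
  rw [← proj_eq_self_of_supp (b := b) (x := x) (n := 0) (by simp [hn])]
  simp

/-- Normalized block-sequences have uniformly bounded biorthogonal functionals. -/
theorem exists_biorthogonal_bound [CompleteSpace X] (b : SchauderBasis 𝕜 X) :
    ∃ M : ℝ, 0 < M ∧ ∀ y : ℕ → X, IsBlockSeq b y → (∀ n, ‖y n‖ = 1) →
      ∃ f : ℕ → StrongDual 𝕜 X, (∀ n, ‖f n‖ ≤ M) ∧
        ∀ n m, f n (y m) = if n = m then 1 else 0 := by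
  obtain ⟨C, hC⟩ := b.exists_norm_proj_le
  have hC0 : 0 ≤ C := (norm_nonneg _).trans (hC 0)
  -- The projection onto an interval of coordinates has norm at most 2C; the 1 ensures positivity.
  refine ⟨C + C + 1, by positivity, fun y hy hn => ?_⟩
  have key : ∀ n, ∃ f : StrongDual 𝕜 X, ‖f‖ ≤ C + C + 1 ∧
      ∀ m, f (y m) = if n = m then 1 else 0 := by
    intro n
    obtain ⟨g, hg, hgy⟩ := exists_dual_vector 𝕜 (y n) (by simp [hn n])
    have hne := (hy.1 n).supp_nonempty
    let S := (hy.1 n).2.toFinset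
    have hS : S.Nonempty := by simpa [S] using hne
    have hmem : ∀ i, i ∈ S ↔ i ∈ supp b (y n) := fun i => by simp [S]
    let p := S.min' hS
    let q := S.max' hS + 1
    have hp : p ∈ supp b (y n) := (hmem _).1 (S.min'_mem hS)
    have hq : S.max' hS ∈ supp b (y n) := (hmem _).1 (S.max'_mem hS)
    -- The norming functional of `y n` is restricted to the interval [p, q) spanned by its support;
    -- every other term is supported entirely on one side of it.
    refine ⟨g.comp (b.proj q - b.proj p), ?_, fun m => ?_⟩
    · refine (ContinuousLinearMap.opNorm_comp_le _ _).trans ?_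
      rw [hg, one_mul]
      exact (norm_sub_le _ _).trans (by linarith [hC q, hC p])
    · rw [ContinuousLinearMap.comp_apply, _root_.sub_apply]
      rcases lt_trichotomy n m with h | h | h
      · have hlt := hy.2 n m h
        rw [if_neg h.ne, proj_eq_zero_of_supp fun i hi => hlt _ hq i hi,
          proj_eq_zero_of_supp fun i hi => (hlt _ hp i hi).le]
        simp
      · subst h
        rw [if_pos rfl, proj_eq_self_of_supp fun i hi =>
            Nat.lt_succ_of_le (S.le_max' i ((hmem i).2 hi)),
          proj_eq_zero_of_supp fun i hi => S.min'_le i ((hmem i).2 hi), sub_zero, hgy, hn]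
        simp
      · have hlt := hy.2 m n h
        rw [if_neg h.ne',
          proj_eq_self_of_supp fun i hi => (hlt i hi _ hq).trans (Nat.lt_succ_self _),
          proj_eq_self_of_supp fun i hi => hlt i hi _ hp]
        simp
  choose f h1 h2 using key
  exact ⟨f, h1, h2⟩

/-- The principle of small perturbations. -/
theorem exists_perturbation_bound [CompleteSpace X] (b : SchauderBasis 𝕜 X) :
    ∃ δ : ℕ → ℝ, (∀ n, 0 < δ n) ∧ ∀ y z : ℕ → X, IsBlockSeq b y → (∀ n, ‖y n‖ = 1) →
      (∀ n, ‖z n - y n‖ ≤ δ n + δ n) → BddIso 2 (closedSpan 𝕜 y) (closedSpan 𝕜 z) := by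
  obtain ⟨M, hM, H⟩ := exists_biorthogonal_bound b
  -- The numerators sum to 1, and 8M absorbs the bound M and the doubled tolerance, so U below has
  -- norm at most 1/4.
  refine ⟨fun n => (1 / 2 / 2 ^ n) / (8 * M), fun n => by positivity, fun y z hy hn hz => ?_⟩
  obtain ⟨f, hf, hfy⟩ := H y hy hn
  let t : ℕ → (X →L[𝕜] X) := fun n => (f n).smulRight (y n - z n)
  have ht : ∀ n, ‖t n‖ ≤ (1 / 2 / 2 ^ n) * (1 / 4) := by
    intro n
    rw [ContinuousLinearMap.norm_smulRight_apply, norm_sub_rev]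
    calc _ ≤ M * ((1 / 2 / 2 ^ n) / (8 * M) + (1 / 2 / 2 ^ n) / (8 * M)) := by
          gcongr
          · exact hf n
          · exact hz n
      _ = (1 / 2 / 2 ^ n) * (1 / 4) := by field_simp; norm_num
  have hs : HasSum (fun n : ℕ => (1 / 2 / 2 ^ n : ℝ) * (1 / 4)) (1 * (1 / 4)) :=
    (hasSum_geometric_two' 1 |>.mul_right _)
  have hsum : Summable t := .of_norm_bounded hs.summable ht
  obtain ⟨U, hU⟩ := hsum
  have hU1 : ‖U‖ ≤ 1 / 2 := by
    have := hU.norm_le_of_bounded hs ht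
    linarith
  have hUy : ∀ m, U (y m) = y m - z m := by
    intro m
    have h1 : HasSum (fun n => t n (y m)) (U (y m)) :=
      hU.map (AddMonoidHom.mk' (fun A : X →L[𝕜] X => A (y m)) fun A B => rfl)
        (ContinuousLinearMap.apply 𝕜 X (y m)).continuous
    have h2 : HasSum (fun n => t n (y m)) (t m (y m)) :=
      hasSum_single m fun n hnm => by simp [t, hfy, hnm]
    rw [h1.unique h2]
    simp [t, hfy]
  -- The operator 1 - U sends each `y m` to `z m`; since ‖U‖ ≤ 1/2, it and its inverse are bounded
  -- by 2.
  let u := Units.oneSub U (by linarith)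
  have hu1 : ∀ v, (u : X →L[𝕜] X) v = v - U v := fun v => rfl
  have hinv1 : ∀ v, ((u⁻¹ : (X →L[𝕜] X)ˣ) : X →L[𝕜] X) ((u : X →L[𝕜] X) v) = v := fun v =>
    congrArg (fun A : X →L[𝕜] X => A v) u.inv_mul
  have hinv2 : ∀ v, (u : X →L[𝕜] X) (((u⁻¹ : (X →L[𝕜] X)ˣ) : X →L[𝕜] X) v) = v := fun v =>
    congrArg (fun A : X →L[𝕜] X => A v) u.mul_inv
  have hUv : ∀ v, ‖U v‖ ≤ 1 / 2 * ‖v‖ := fun v => U.le_of_opNorm_le hU1 v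
  have hyz : ∀ n, (u : X →L[𝕜] X) (y n) = z n := fun n => by rw [hu1, hUy]; abel
  refine bddIso_of_maps (u : X →L[𝕜] X) ((u⁻¹ : (X →L[𝕜] X)ˣ) : X →L[𝕜] X) hyz
    (fun n => by rw [← hyz, hinv1]) ?_ ?_
  · refine ContinuousLinearMap.opNorm_le_bound _ (by norm_num) fun v => ?_
    rw [hu1]
    linarith [norm_sub_le v (U v), hUv v, norm_nonneg v]
  · refine ContinuousLinearMap.opNorm_le_bound _ (by norm_num) fun v => ?_
    set w := ((u⁻¹ : (X →L[𝕜] X)ˣ) : X →L[𝕜] X) v with hw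
    have h1 : w - U w = v := by rw [← hu1, hinv2]
    have h2 : w = v + U w := by rw [← h1]; abel
    have h3 := norm_add_le v (U w)
    rw [← h2] at h3
    linarith [hUv w]

/-- Normalized block-sequences which agree from the index `l` on span uniformly isomorphic
spaces. -/
theorem exists_bddIso_of_eventuallyEq [CompleteSpace X] (b : SchauderBasis 𝕜 X) (l : ℕ) :
    ∃ K : ℝ, ∀ y z : ℕ → X, IsBlockSeq b y → (∀ n, ‖y n‖ = 1) → IsBlockSeq b z →
      (∀ n, ‖z n‖ = 1) → (∀ n, l ≤ n → y n = z n) →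
      BddIso K (closedSpan 𝕜 y) (closedSpan 𝕜 z) := by
  obtain ⟨M, hM, H⟩ := exists_biorthogonal_bound b
  have key : ∀ y z : ℕ → X, IsBlockSeq b y → (∀ n, ‖y n‖ = 1) → (∀ n, ‖z n‖ = 1) →
      (∀ n, l ≤ n → y n = z n) → ∃ T : X →L[𝕜] X, (∀ n, T (y n) = z n) ∧
        ‖T‖ ≤ 1 + l * (M * 2) := by
    intro y z hy hyn hzn heq
    obtain ⟨f, hf, hfy⟩ := H y hy hyn
    -- A finite-rank correction of the identity replaces the first l terms; each summand has norm at
    -- most 2M.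
    refine ⟨.id 𝕜 X + ∑ n ∈ Finset.range l, (f n).smulRight (z n - y n), fun n => ?_, ?_⟩
    · have : ∀ i, f i (y n) • (z i - y i) = if i = n then z n - y n else 0 := by
        intro i
        rw [hfy]
        split_ifs with h <;> simp [h]
      simp only [_root_.add_apply, ContinuousLinearMap.id_apply, _root_.sum_apply,
        ContinuousLinearMap.smulRight_apply, this, Finset.sum_ite_eq', Finset.mem_range]
      split_ifs with h
      · abel
      · rw [add_zero, heq n (not_lt.1 h)]
    · refine (norm_add_le _ _).trans (add_le_add ContinuousLinearMap.norm_id_le ?_)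
      refine (norm_sum_le _ _).trans ?_
      refine (Finset.sum_le_card_nsmul _ _ (M * 2) fun i _ => ?_).trans (by simp)
      rw [ContinuousLinearMap.norm_smulRight_apply]
      gcongr
      · exact hf i
      · exact (norm_sub_le _ _).trans (by rw [hyn, hzn]; norm_num)
  refine ⟨1 + l * (M * 2), fun y z hy hyn hz hzn heq => ?_⟩
  obtain ⟨T, hT, hTK⟩ := key y z hy hyn hzn heq
  obtain ⟨S, hS, hSK⟩ := key z y hz hzn hyn fun n hn => (heq n hn).symm
  exact bddIso_of_maps T S hT hS hTK hSK

/-- Uniform isomorphisms between the spans of the sequences without their first terms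
give uniform isomorphisms between the spans. -/
theorem exists_bddIso_of_tail [CompleteSpace X] (b : SchauderBasis 𝕜 X) (K : ℝ) :
    ∃ L : ℝ, ∀ y z : ℕ → X, IsBlockSeq b y → (∀ n, ‖y n‖ = 1) → IsBlockSeq b z →
      (∀ n, ‖z n‖ = 1) →
      BddIso K (closedSpan 𝕜 fun n => y (n + 1)) (closedSpan 𝕜 fun n => z (n + 1)) →
      BddIso L (closedSpan 𝕜 y) (closedSpan 𝕜 z) := by
  obtain ⟨M, hM, H⟩ := exists_biorthogonal_bound b
  have key : ∀ y z : ℕ → X, IsBlockSeq b y → (∀ n, ‖y n‖ = 1) → (∀ n, ‖z n‖ = 1) →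
      ∀ U : (closedSpan 𝕜 fun n => y (n + 1)) →L[𝕜] (closedSpan 𝕜 fun n => z (n + 1)), ‖U‖ ≤ K →
      ∃ V : closedSpan 𝕜 y →L[𝕜] closedSpan 𝕜 z,
        ((V ⟨y 0, mem_closedSpan y 0⟩ : closedSpan 𝕜 z) : X) = z 0 ∧
        (∀ (v : closedSpan 𝕜 fun n => y (n + 1)) (hv : (v : X) ∈ closedSpan 𝕜 y),
          ((V ⟨v, hv⟩ : closedSpan 𝕜 z) : X) = (U v : X)) ∧ ‖V‖ ≤ M + K * (1 + M) := by
    intro y z hy hyn hzn U hUK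
    have hK : 0 ≤ K := (norm_nonneg _).trans hUK
    obtain ⟨f, hf, hfy⟩ := H y hy hyn
    -- P projects [y] onto the span of the tail along `y 0`. The extension of U is v ↦ f₀(v) z₀ +
    -- U(P v).
    let P : X →L[𝕜] X := .id 𝕜 X - (f 0).smulRight (y 0)
    have hP0 : P (y 0) = 0 := by simp [P, hfy]
    have hPn : ∀ n, P (y (n + 1)) = y (n + 1) := fun n => by simp [P, hfy]
    have hPm : ∀ v ∈ closedSpan 𝕜 y, P v ∈ closedSpan 𝕜 fun n => y (n + 1) := by
      intro v hv
      refine map_mem_of_mem_closedSpan (isClosed_closedSpan _) P (fun n => ?_) hv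
      cases n with
      | zero => rw [hP0]; exact zero_mem _
      | succ n => rw [hPn]; exact mem_closedSpan (fun n => y (n + 1)) n
    have hPv : ∀ v ∈ (closedSpan 𝕜 fun n => y (n + 1)), f 0 v = 0 := by
      intro v hv
      exact closedSpan_le (Z := LinearMap.ker (f 0 : X →ₗ[𝕜] 𝕜))
        (ContinuousLinearMap.isClosed_ker (f 0)) (fun n => by simp [hfy]) hv
    have hle : (closedSpan 𝕜 fun n => z (n + 1)) ≤ closedSpan 𝕜 z :=
      closedSpan_le (isClosed_closedSpan z) fun n => mem_closedSpan z (n + 1)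
    let P' : closedSpan 𝕜 y →L[𝕜] (closedSpan 𝕜 fun n => y (n + 1)) :=
      (P.comp (closedSpan 𝕜 y).subtypeL).codRestrict _ fun v => hPm v v.2
    let V₀ : closedSpan 𝕜 y →L[𝕜] X :=
      ((f 0).smulRight (z 0)).comp (closedSpan 𝕜 y).subtypeL +
        (closedSpan 𝕜 fun n => z (n + 1)).subtypeL.comp (U.comp P')
    have hV₀ : ∀ v, V₀ v = f 0 (v : X) • z 0 + (U (P' v) : X) := fun v => rfl
    have hV₀m : ∀ v, V₀ v ∈ closedSpan 𝕜 z := fun v => by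
      rw [hV₀]
      exact add_mem (Submodule.smul_mem _ _ (mem_closedSpan z 0)) (hle (U (P' v)).2)
    refine ⟨V₀.codRestrict _ hV₀m, ?_, ?_, ?_⟩
    · have hz : P' ⟨y 0, mem_closedSpan y 0⟩ = 0 := Subtype.ext hP0
      change V₀ _ = _
      rw [hV₀, hz]
      simp [hfy]
    · intro v hv
      have hz : P' ⟨v, hv⟩ = v := Subtype.ext (by simp [P', P, hPv v v.2])
      change V₀ _ = _
      rw [hV₀, hz, hPv v v.2]
      simp
    · refine ContinuousLinearMap.opNorm_le_bound _ (by positivity) fun v => ?_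
      change ‖V₀ v‖ ≤ _
      rw [hV₀]
      have hfv : ‖f 0 (v : X)‖ ≤ M * ‖v‖ := (f 0).le_of_opNorm_le (hf 0) (v : X)
      have h1 : ‖f 0 (v : X) • z 0‖ ≤ M * ‖v‖ := by
        rw [norm_smul, hzn, mul_one]
        exact hfv
      have h2 : ‖P' v‖ ≤ (1 + M) * ‖v‖ := by
        change ‖(v : X) - f 0 (v : X) • y 0‖ ≤ _
        refine (norm_sub_le _ _).trans ?_
        rw [norm_smul, hyn, mul_one, add_mul, one_mul]
        exact add_le_add le_rfl hfv
      have h3 : ‖(U (P' v) : X)‖ ≤ K * ((1 + M) * ‖v‖) :=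
        (U.le_of_opNorm_le hUK (P' v)).trans (by gcongr)
      refine (norm_add_le _ _).trans ?_
      linarith
  refine ⟨M + K * (1 + M), fun y z hy hyn hz hzn ⟨U, hU, hU'⟩ => ?_⟩
  obtain ⟨V, hV0, hV, hVn⟩ := key y z hy hyn hzn U hU
  obtain ⟨W, hW0, hW, hWn⟩ := key z y hz hzn hyn U.symm hU'
  have comp_id : ∀ {y z : ℕ → X}
      (U : (closedSpan 𝕜 fun n => y (n + 1)) ≃L[𝕜] (closedSpan 𝕜 fun n => z (n + 1)))
      (V : closedSpan 𝕜 y →L[𝕜] closedSpan 𝕜 z) (W : closedSpan 𝕜 z →L[𝕜] closedSpan 𝕜 y),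
      ((V ⟨y 0, mem_closedSpan y 0⟩ : closedSpan 𝕜 z) : X) = z 0 →
      (∀ (v : closedSpan 𝕜 fun n => y (n + 1)) (hv : (v : X) ∈ closedSpan 𝕜 y),
          ((V ⟨v, hv⟩ : closedSpan 𝕜 z) : X) = (U v : X)) →
      ((W ⟨z 0, mem_closedSpan z 0⟩ : closedSpan 𝕜 y) : X) = y 0 →
      (∀ (v : closedSpan 𝕜 fun n => z (n + 1)) (hv : (v : X) ∈ closedSpan 𝕜 z),
          ((W ⟨v, hv⟩ : closedSpan 𝕜 y) : X) = (U.symm v : X)) →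
      ∀ v, W (V v) = v := by
    intro y z U V W hV0 hV hW0 hW
    have hle : (closedSpan 𝕜 fun n => z (n + 1)) ≤ closedSpan 𝕜 z :=
      closedSpan_le (isClosed_closedSpan z) fun n => mem_closedSpan z (n + 1)
    have : W.comp V = .id 𝕜 _ := by
      refine closedSpan_induction _ _ fun n => ?_
      rw [ContinuousLinearMap.comp_apply, ContinuousLinearMap.id_apply]
      cases n with
      | zero =>
        have : V ⟨y 0, mem_closedSpan y 0⟩ = ⟨z 0, mem_closedSpan z 0⟩ := Subtype.ext hV0
        rw [this]
        exact Subtype.ext hW0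
      | succ n =>
        let v : closedSpan 𝕜 fun n => y (n + 1) :=
          ⟨y (n + 1), mem_closedSpan (fun n => y (n + 1)) n⟩
        have : V ⟨y (n + 1), mem_closedSpan y (n + 1)⟩ = ⟨U v, hle (U v).2⟩ :=
          Subtype.ext (hV v (mem_closedSpan y (n + 1)))
        rw [this]
        refine Subtype.ext ((hW (U v) _).trans ?_)
        rw [U.symm_apply_apply]
    exact fun v => congrArg (fun A : closedSpan 𝕜 y →L[𝕜] closedSpan 𝕜 y => A v) this
  exact bddIso_of_inverse V W (comp_id U V W hV0 hV hW0 hW)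
    (comp_id U.symm W V hW0 hW hV0 (by simpa using hV)) hVn hWn

theorem IsBlockSeq.shift {b : SchauderBasis 𝕜 X} {y : ℕ → X} (hy : IsBlockSeq b y) (d : ℕ) :
    IsBlockSeq b fun n => y (n + d) :=
  ⟨fun n => hy.1 _, fun m n h => hy.2 _ _ (by omega)⟩

/-- The missing terms are put back one at a time. What matters is that the final bound depends only
on `b`, K and d. -/
theorem exists_bddIso_of_shift [CompleteSpace X] (b : SchauderBasis 𝕜 X) (K : ℝ) (d : ℕ) :
    ∃ L : ℝ, ∀ y z : ℕ → X, IsBlockSeq b y → (∀ n, ‖y n‖ = 1) → IsBlockSeq b z →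
      (∀ n, ‖z n‖ = 1) →
      BddIso K (closedSpan 𝕜 fun n => y (n + d)) (closedSpan 𝕜 fun n => z (n + d)) →
      BddIso L (closedSpan 𝕜 y) (closedSpan 𝕜 z) := by
  induction d generalizing K with
  | zero => exact ⟨K, fun y z _ _ _ _ h => h⟩
  | succ d ih =>
    obtain ⟨L, hL⟩ := exists_bddIso_of_tail b K
    obtain ⟨L', hL'⟩ := ih L
    refine ⟨L', fun y z hy hyn hz hzn h => hL' y z hy hyn hz hzn ?_⟩
    refine hL _ _ (hy.shift d) (fun n => hyn _) (hz.shift d) (fun n => hzn _) ?_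
    simpa only [add_assoc, add_comm 1 d] using h

end BlockSpaces

/-! ### Normalized rational blocks -/

section RationalBlocks

variable {𝕜 X : Type*} [RCLike 𝕜] [NormedAddCommGroup X] [NormedSpace 𝕜 X]
  {b : SchauderBasis 𝕜 X}

theorem supp_smul {c : 𝕜} (hc : c ≠ 0) (x : X) : supp b (c • x) = supp b x := by
  ext i
  simp [supp, hc]

theorem IsBlock.smul {c : 𝕜} (hc : c ≠ 0) {x : X} (hx : IsBlock b x) : IsBlock b (c • x) :=
  ⟨smul_ne_zero hc hx.1, by rw [supp_smul hc]; exact hx.2⟩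

theorem inv_norm_ne_zero {𝕜 X : Type*} [RCLike 𝕜] [NormedAddCommGroup X] {x : X}
    (hx : x ≠ 0) : ((‖x‖⁻¹ : ℝ) : 𝕜) ≠ 0 := by
  simpa using hx

theorem norm_normalize {x : X} (hx : x ≠ 0) : ‖((‖x‖⁻¹ : ℝ) : 𝕜) • x‖ = 1 := by
  rw [norm_smul, RCLike.norm_ofReal, abs_of_nonneg (by positivity)]
  exact inv_mul_cancel₀ (norm_ne_zero_iff.2 hx)

theorem isBlock_of_mem_ratBlocks {x : X} (hx : x ∈ ratBlocks b) : IsBlock b x := by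
  obtain ⟨r, hr, -, rfl⟩ := hx
  exact hr.smul (inv_norm_ne_zero hr.1)

theorem norm_of_mem_ratBlocks {x : X} (hx : x ∈ ratBlocks b) : ‖x‖ = 1 := by
  obtain ⟨r, hr, -, rfl⟩ := hx
  exact norm_normalize hr.1

theorem BBd.isBlockSeq (y : BBd b) : IsBlockSeq b y.seq := y.2

theorem BBd.norm_seq (y : BBd b) (n : ℕ) : ‖y.seq n‖ = 1 := norm_of_mem_ratBlocks (y.1 n).2

theorem coord_sum_smul (S : Finset ℕ) (c : ℕ → 𝕜) (i : ℕ) :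
    b.coord i (∑ j ∈ S, c j • b j) = if i ∈ S then c i else 0 := by
  simp [b.ortho, Pi.single_apply]

theorem eq_sum_of_supp_subset {x : X} {S : Finset ℕ} (h : supp b x ⊆ S) :
    x = ∑ i ∈ S, b.coord i x • b i := by
  have hn : ∀ i ∈ supp b x, i < S.sup id + 1 := fun i hi =>
    Nat.lt_succ_of_le (Finset.le_sup (f := id) (h hi))
  conv_lhs => rw [← proj_eq_self_of_supp hn, SchauderBasis.proj_apply]
  symm
  refine Finset.sum_subset (fun i hi => ?_) fun i _ hi => ?_
  · exact Finset.mem_range.2 (Nat.lt_succ_of_le (Finset.le_sup (f := id) hi))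
  · have : b.coord i x = 0 := by
      by_contra hc
      exact hi (h hc)
    rw [this, zero_smul]

instance instCountableRatBlock (b : SchauderBasis 𝕜 X) : Countable (RatBlock b) := by
  let g : (ℕ →₀ ℚ × ℚ) → X := fun c =>
    ∑ i ∈ c.support, (((c i).1 : 𝕜) + ((c i).2 : 𝕜) * RCLike.I) • b i
  have : (ratBlocks b).Countable := by
    refine ((countable_range g).image fun r => ((‖r‖⁻¹ : ℝ) : 𝕜) • r).mono ?_
    rintro x ⟨r, hr, hrat, rfl⟩
    refine ⟨r, ?_, rfl⟩
    choose p q hpq using hrat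
    classical
    let c : ℕ →₀ ℚ × ℚ := Finsupp.onFinset hr.2.toFinset
      (fun i => if b.coord i r = 0 then 0 else (p i, q i)) fun i hi => by
        rw [Finite.mem_toFinset]
        intro h
        exact hi (if_pos h)
    have hc : supp b r ⊆ c.support := by
      intro i hi
      have hi' : b.coord i r ≠ 0 := hi
      rw [Finset.mem_coe, Finsupp.mem_support_iff, Finsupp.onFinset_apply, if_neg hi']
      intro h0
      rw [Prod.mk_eq_zero] at h0
      apply hi'
      rw [hpq i, h0.1, h0.2]
      simp
    refine ⟨c, ?_⟩
    rw [eq_sum_of_supp_subset hc]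
    refine Finset.sum_congr rfl fun i hi => ?_
    have hi' : b.coord i r ≠ 0 := by
      intro h
      exact (Finsupp.mem_support_iff.1 hi) (if_pos h)
    have hci : c i = (p i, q i) := if_neg hi'
    rw [hci, ← hpq]
  exact this.to_subtype

/-- Zero is excluded so that approximating the coordinates of a block never shrinks its support. -/
theorem dense_ratScalar : Dense {c : 𝕜 | IsRatScalar c ∧ c ≠ 0} := by
  have h1 : DenseRange fun p : ℚ × ℚ => (((p.1 : ℝ) : 𝕜) + ((p.2 : ℝ) : 𝕜) * RCLike.I) := by
    have hs : Function.Surjective fun p : ℝ × ℝ => ((p.1 : 𝕜) + (p.2 : 𝕜) * RCLike.I) :=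
      fun z => ⟨(RCLike.re z, RCLike.im z), RCLike.re_add_im z⟩
    have hc : Continuous fun p : ℝ × ℝ => ((p.1 : 𝕜) + (p.2 : 𝕜) * RCLike.I) := by fun_prop
    exact hs.denseRange.comp (Rat.denseRange_cast.prodMap Rat.denseRange_cast) hc
  have h2 : Dense {c : 𝕜 | IsRatScalar c} := by
    refine h1.mono ?_
    rintro _ ⟨p, rfl⟩
    exact ⟨p.1, p.2, by simp⟩
  exact h2.sdiff_singleton 0

/-- Normalized blocks are limits of normalized rational blocks with the same support. -/
theorem exists_ratBlock_near {v : X} (hv : IsBlock b v) (hn : ‖v‖ = 1) {ε : ℝ} (hε : 0 < ε) :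
    ∃ q ∈ ratBlocks b, supp b q = supp b v ∧ ‖q - v‖ ≤ ε := by
  let S := hv.2.toFinset
  have hS : ∀ i, i ∈ S ↔ i ∈ supp b v := fun i => by simp [S]
  let r : (ℕ → 𝕜) → X := fun c => ∑ i ∈ S, c i • b i
  have hr : Continuous r := by fun_prop
  let c₀ : ℕ → 𝕜 := fun i => b.coord i v
  have hr₀ : r c₀ = v := (eq_sum_of_supp_subset fun i hi => (hS i).2 hi).symm
  let g : (ℕ → 𝕜) → X := fun c => ((‖r c‖⁻¹ : ℝ) : 𝕜) • r c
  have hg : ContinuousAt g c₀ := by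
    have h1 : ContinuousAt (fun c => (‖r c‖⁻¹ : ℝ)) c₀ :=
      hr.norm.continuousAt.inv₀ (by rw [hr₀, hn]; exact one_ne_zero)
    exact (RCLike.continuous_ofReal.continuousAt.comp h1).smul hr.continuousAt
  have hg₀ : g c₀ = v := by simp [g, hr₀, hn]
  have hnear : {c | ‖g c - v‖ < ε} ∈ 𝓝 c₀ := by
    have := hg.preimage_mem_nhds (Metric.ball_mem_nhds _ hε)
    rw [hg₀] at this
    filter_upwards [this] with c hc
    simpa [dist_eq_norm] using hc
  -- Normalization is continuous near the coordinates of v, so nearby nonzero rational coordinates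
  -- suffice; those outside S play no role.
  obtain ⟨c, hcS, hc⟩ := (dense_pi (univ : Set ℕ) fun _ _ =>
    dense_ratScalar (𝕜 := 𝕜)).inter_nhds_nonempty hnear
  have hcr : ∀ i, IsRatScalar (c i) ∧ c i ≠ 0 := fun i => hcS i trivial
  have hsupp : supp b (r c) = supp b v := by
    ext i
    rw [← hS]
    simp only [supp, r, mem_ofPred_eq, coord_sum_smul]
    split_ifs with h <;> simp [h, (hcr i).2]
  have hblock : IsBlock b (r c) := by
    refine ⟨fun h0 => ?_, by rw [hsupp]; exact hv.2⟩
    obtain ⟨i, hi⟩ := hv.supp_nonempty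
    rw [← hsupp, h0] at hi
    exact hi (by simp)
  refine ⟨g c, ⟨r c, hblock, fun i => ?_, rfl⟩, ?_, hc.out.le⟩
  · simp only [r, coord_sum_smul]
    split_ifs
    · exact (hcr i).1
    · exact ⟨0, 0, by simp⟩
  · rw [supp_smul (inv_norm_ne_zero hblock.1), hsupp]

/-- Rational blocks with given support have finite nets. -/
theorem exists_finite_net (b : SchauderBasis 𝕜 X) (S : Finset ℕ) {ε : ℝ} (hε : 0 < ε) :
    ∃ G : Set (RatBlock b), G.Finite ∧ (∀ q ∈ G, supp b q.1 = S) ∧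
      ∀ v : RatBlock b, supp b v.1 = S → ∃ q ∈ G, ‖q.1 - v.1‖ ≤ ε := by
  let F : Submodule 𝕜 X := Submodule.span 𝕜 (b '' S)
  have : FiniteDimensional 𝕜 F := FiniteDimensional.span_of_finite 𝕜 (S.finite_toSet.image _)
  have : ProperSpace F := FiniteDimensional.proper 𝕜 F
  have htb : TotallyBounded {x : X | x ∈ ratBlocks b ∧ supp b x = S} := by
    refine ((isCompact_closedBall (0 : F) 1).image continuous_subtype_val).totallyBounded.subset ?_
    rintro x ⟨hx, hxS⟩
    have hxF : x ∈ F := by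
      rw [eq_sum_of_supp_subset hxS.subset]
      exact Submodule.sum_mem _ fun i hi =>
        Submodule.smul_mem _ _ (Submodule.subset_span ⟨i, hi, rfl⟩)
    refine ⟨⟨x, hxF⟩, ?_, rfl⟩
    rw [mem_closedBall_zero_iff]
    exact (norm_of_mem_ratBlocks hx).le
  -- The net is taken inside the set itself, so its points are rational blocks with support S.
  obtain ⟨t, hts, htf, ht⟩ := totallyBounded_iff_subset.1 htb _ (Metric.dist_mem_uniformity hε)
  refine ⟨{q | q.1 ∈ t}, htf.preimage Subtype.val_injective.injOn, fun q hq => (hts hq).2, ?_⟩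
  intro v hv
  obtain ⟨x, hx, hxv⟩ := mem_iUnion₂.1 (ht ⟨v.2, hv⟩)
  refine ⟨⟨x, (hts hx).1⟩, hx, ?_⟩
  have : dist v.1 x < ε := hxv
  rw [dist_comm, dist_eq_norm] at this
  exact this.le

/-- The normalized basis vectors. -/
theorem exists_ratBlock_supp_singleton (b : SchauderBasis 𝕜 X) (k : ℕ) :
    ∃ q : RatBlock b, supp b q.1 = {k} := by
  have hs : supp b (b k) = {k} := by
    ext i
    simp [supp, b.ortho, Pi.single_apply]
  have h0 : b k ≠ 0 := fun h => by
    have := b.ortho k k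
    rw [h] at this
    simp at this
  refine ⟨⟨_, b k, ⟨h0, by simp [hs]⟩, fun i => ?_, rfl⟩, ?_⟩
  · by_cases h : i = k
    · exact ⟨1, 0, by simp [b.ortho, h]⟩
    · exact ⟨0, 0, by simp [b.ortho, h]⟩
  · exact (supp_smul (inv_norm_ne_zero h0) _).trans hs

end RationalBlocks

/-! ### Cylinders in the space of block-sequences -/

section Cylinders

variable {𝕜 X : Type*} [RCLike 𝕜] [NormedAddCommGroup X] [NormedSpace 𝕜 X]
  {b : SchauderBasis 𝕜 X}

/-- The support of `p` lies before that of `q`. -/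
def Before (p q : RatBlock b) : Prop := SuppLT b p.1 q.1

/-- All terms of `l` have their support in `[0, k)`. -/
def Below (k : ℕ) (l : List (RatBlock b)) : Prop := ∀ q ∈ l, ∀ i ∈ supp b q.1, i < k

/-- All terms of `l` have their support in `[k, ∞)`. -/
def Above (k : ℕ) (l : List (RatBlock b)) : Prop := ∀ q ∈ l, ∀ i ∈ supp b q.1, k ≤ i

theorem RatBlock.supp_nonempty (q : RatBlock b) : (supp b q.1).Nonempty :=
  (isBlock_of_mem_ratBlocks q.2).supp_nonempty

theorem RatBlock.supp_finite (q : RatBlock b) : (supp b q.1).Finite :=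
  (isBlock_of_mem_ratBlocks q.2).2

theorem exists_below (l : List (RatBlock b)) : ∃ k, Below k l := by
  induction l with
  | nil => exact ⟨0, by simp [Below]⟩
  | cons q l ih =>
    obtain ⟨k, hk⟩ := ih
    obtain ⟨m, hm⟩ := q.supp_finite.bddAbove
    refine ⟨max k (m + 1), fun p hp i hi => ?_⟩
    rcases List.mem_cons.1 hp with rfl | hp
    · exact lt_max_of_lt_right (Nat.lt_succ_of_le (hm hi))
    · exact lt_max_of_lt_left (hk p hp i hi)

theorem Below.mono {k m : ℕ} (h : k ≤ m) {l : List (RatBlock b)} (hl : Below k l) : Below m l :=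
  fun q hq i hi => (hl q hq i hi).trans_le h

theorem exists_below_of_finite {P : Set (List (RatBlock b))} (hP : P.Finite) :
    ∃ k, ∀ l ∈ P, Below k l := by
  choose k hk using exists_below (b := b)
  obtain ⟨m, hm⟩ := (hP.image k).bddAbove
  exact ⟨m, fun l hl => (hk l).mono (hm (mem_image_of_mem k hl))⟩

theorem pairwise_append {k : ℕ} {l s : List (RatBlock b)} (hl : l.Pairwise Before)
    (hs : s.Pairwise Before) (hlk : Below k l) (hsk : Above k s) : (l ++ s).Pairwise Before :=
  List.pairwise_append.2 ⟨hl, hs, fun p hp q hq i hi j hj =>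
    (hlk p hp i hi).trans_le (hsk q hq j hj)⟩

/-- The first `m` terms of a block-sequence. -/
def BBd.pre (y : BBd b) (m : ℕ) : List (RatBlock b) := (List.range m).map y.1

theorem BBd.length_pre (y : BBd b) (m : ℕ) : (y.pre m).length = m := by simp [BBd.pre]

theorem BBd.getElem_pre (y : BBd b) (m i : ℕ) (h : i < (y.pre m).length) :
    (y.pre m)[i] = y.1 i := by simp [BBd.pre]

theorem BBd.pairwise_pre (y : BBd b) (m : ℕ) : (y.pre m).Pairwise Before := by
  rw [BBd.pre, List.pairwise_map]
  exact List.pairwise_lt_range.imp fun h => y.2.2 _ _ h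

/-- The block-sequences which start with `l`. -/
def cyl (l : List (RatBlock b)) : Set (BBd b) := {y | y.pre l.length = l}

theorem mem_cyl_iff {l : List (RatBlock b)} {y : BBd b} :
    y ∈ cyl l ↔ ∀ (i : ℕ) (h : i < l.length), y.1 i = l[i] := by
  constructor
  · intro h i hi
    have h' : y.pre l.length = l := h
    rw [← y.getElem_pre l.length i (by simpa [BBd.length_pre] using hi)]
    simp [h']
  · intro h
    exact List.ext_getElem (y.length_pre _) fun i h1 h2 => by rw [y.getElem_pre, h i h2]

theorem BBd.mem_cyl_pre (y : BBd b) (m : ℕ) : y ∈ cyl (y.pre m) := by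
  change y.pre (y.pre m).length = y.pre m
  rw [y.length_pre]

theorem exists_pre_eq_append {l : List (RatBlock b)} {y : BBd b} (hy : y ∈ cyl l) {m : ℕ}
    (hm : l.length ≤ m) : ∃ s, y.pre m = l ++ s := by
  refine ⟨(y.pre m).drop l.length, ?_⟩
  have h : y.pre l.length = l := hy
  conv_rhs => rw [← h]
  rw [y.length_pre]
  have h2 : y.pre l.length = (y.pre m).take l.length := by
    simp [BBd.pre, ← List.map_take, List.take_range, hm]
  rw [h2, List.take_append_drop]

theorem cyl_append_subset (l s : List (RatBlock b)) : cyl (l ++ s) ⊆ cyl l := by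
  intro y hy
  rw [mem_cyl_iff] at hy ⊢
  intro i hi
  rw [hy i (by rw [List.length_append]; omega), List.getElem_append_left]

theorem continuous_term (n : ℕ) : Continuous fun y : BBd b => y.1 n :=
  (continuous_apply n).comp continuous_subtype_val

theorem isOpen_cyl (l : List (RatBlock b)) : IsOpen (cyl l) := by
  have : cyl l = ⋂ i : Fin l.length, {y : BBd b | y.1 i = l[i]} := by
    ext y
    simp only [mem_cyl_iff, mem_iInter, mem_ofPred_eq]
    exact ⟨fun h i => h i i.2, fun h i hi => h ⟨i, hi⟩⟩
  rw [this]
  exact isOpen_iInter_of_finite fun i =>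
    (isOpen_discrete {l[i]}).preimage (continuous_term (b := b) i)

theorem exists_cyl_pre_subset {D : Set (BBd b)} (hD : IsOpen D) {y : BBd b} (hy : y ∈ D) :
    ∃ m₀, ∀ m, m₀ ≤ m → cyl (y.pre m) ⊆ D := by
  obtain ⟨U, hU, rfl⟩ := isOpen_induced_iff.1 hD
  obtain ⟨I, u, hu, hIu⟩ := isOpen_pi_iff.1 hU y.1 hy
  refine ⟨I.sup id + 1, fun m hm z hz => hIu fun i hi => ?_⟩
  have him : i < m := (Nat.lt_succ_of_le (Finset.le_sup (f := id) hi)).trans_le hm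
  rw [mem_cyl_iff.1 hz i (by rwa [y.length_pre]), y.getElem_pre]
  exact (hu i hi).2

theorem isBlockSeq_iff (y : ℕ → RatBlock b) :
    IsBlockSeq b (fun n => (y n).1) ↔ ∀ m n, m < n → Before (y m) (y n) :=
  ⟨fun h => h.2, fun h => ⟨fun n => isBlock_of_mem_ratBlocks (y n).2, h⟩⟩

theorem Before.trans {p q r : RatBlock b} (h : Before p q) (h' : Before q r) : Before p r := by
  obtain ⟨j, hj⟩ := q.supp_nonempty
  exact fun i hi k hk => (h i hi j hj).trans (h' j hj k hk)

theorem isBlockSeq_of_succ {y : ℕ → RatBlock b} (h : ∀ n, Before (y n) (y (n + 1))) :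
    IsBlockSeq b fun n => (y n).1 := by
  rw [isBlockSeq_iff]
  intro m n hmn
  induction n, hmn using Nat.le_induction with
  | base => exact h m
  | succ n _ ih => exact ih.trans (h n)

/-- The list is continued by normalized basis vectors beyond its support. -/
theorem cyl_nonempty {l : List (RatBlock b)} (hl : l.Pairwise Before) : (cyl l).Nonempty := by
  obtain ⟨k, hk⟩ := exists_below l
  choose e he using exists_ratBlock_supp_singleton b
  let y : ℕ → RatBlock b := fun n => if h : n < l.length then l[n] else e (k + n)
  have hy : IsBlockSeq b fun n => (y n).1 := by
    rw [isBlockSeq_iff]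
    intro m n hmn
    by_cases hn : n < l.length
    · have hm : m < l.length := hmn.trans hn
      simp only [y, hn, hm, dif_pos]
      exact List.pairwise_iff_getElem.1 hl m n hm hn hmn
    · simp only [y, hn, dif_neg, not_false_eq_true]
      split_ifs with hm
      · intro i hi j hj
        rw [he] at hj
        rw [mem_singleton_iff.1 hj]
        exact (hk _ (List.getElem_mem hm) i hi).trans_le (by omega)
      · intro i hi j hj
        rw [he] at hi hj
        rw [mem_singleton_iff.1 hi, mem_singleton_iff.1 hj]
        omega
  refine ⟨⟨y, hy⟩, mem_cyl_iff.2 fun i hi => ?_⟩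
  simp only [y, hi, dif_pos]

instance instNonemptyBBd : Nonempty (BBd b) := ⟨(cyl_nonempty (l := []) .nil).choose⟩

theorem above_of_append {k : ℕ} {s s' : List (RatBlock b)} (hne : s ≠ []) (hs : Above k s)
    (h : (s ++ s').Pairwise Before) : Above k (s ++ s') := by
  intro q hq i hi
  rcases List.mem_append.1 hq with hq | hq
  · exact hs q hq i hi
  · obtain ⟨p, hp⟩ := List.exists_mem_of_ne_nil s hne
    obtain ⟨j, hj⟩ := p.supp_nonempty
    exact (hs p hp j hj).trans ((List.pairwise_append.1 h).2.2 p hp q hq j hj i hi).le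

/-- Given a dense open set of pairs, finitely many pairs of finite block-sequences have
simultaneous extensions which determine membership in it. -/
theorem exists_simultaneous_extension {D : Set (BBd b × BBd b)} (hD : IsOpen D) (hd : Dense D)
    (k : ℕ) (S : List (List (RatBlock b) × List (RatBlock b)))
    (hS : ∀ p ∈ S, p.1.Pairwise Before ∧ p.2.Pairwise Before ∧ p.1.length = p.2.length ∧
      Below k p.1 ∧ Below k p.2) :
    ∃ s t : List (RatBlock b), (∃ q ∈ s, k ∈ supp b q.1) ∧ t ≠ [] ∧
      s.length = t.length ∧ s.Pairwise Before ∧ t.Pairwise Before ∧ Above k s ∧ Above k t ∧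
      ∀ p ∈ S, cyl (p.1 ++ s) ×ˢ cyl (p.2 ++ t) ⊆ D := by
  induction S with
  | nil =>
    -- Starting from a vector supported at k keeps k in the support of a term of s, so that any list
    -- lying before s is automatically below k.
    obtain ⟨e, he⟩ := exists_ratBlock_supp_singleton b k
    have hk : Above k [e] := by simp [Above, he]
    exact ⟨[e], [e], by simp [he], by simp, rfl, by simp, by simp, hk, hk, by simp⟩
  | cons p S ih =>
    obtain ⟨s, t, ⟨q₀, hq₀, hq₀k⟩, ht0, hst, hs, ht, hsk, htk, H⟩ :=
      ih fun p hp => hS p (List.mem_cons_of_mem _ hp)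
    obtain ⟨hp1, hp2, hlen, hk1, hk2⟩ := hS p List.mem_cons_self
    -- The extensions found for the earlier pairs are prolonged to serve the new pair; cylinders
    -- only shrink, so nothing is lost.
    obtain ⟨⟨y, z⟩, ⟨hy, hz⟩, hyz⟩ := hd.inter_open_nonempty _
      ((isOpen_cyl (p.1 ++ s)).prod (isOpen_cyl (p.2 ++ t)))
      ((cyl_nonempty (pairwise_append hp1 hs hk1 hsk)).prod
        (cyl_nonempty (pairwise_append hp2 ht hk2 htk)))
    obtain ⟨U, V, hU, hV, hyU, hzV, hUV⟩ := isOpen_prod_iff.1 hD y z hyz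
    obtain ⟨m₁, h₁⟩ := exists_cyl_pre_subset hU hyU
    obtain ⟨m₂, h₂⟩ := exists_cyl_pre_subset hV hzV
    -- A common cut m on both sides keeps the two extensions of equal length.
    obtain ⟨m, hm, hm₁, hm₂⟩ : ∃ m, (p.1 ++ s).length ≤ m ∧ m₁ ≤ m ∧ m₂ ≤ m :=
      ⟨max (p.1 ++ s).length (max m₁ m₂), by simp, by simp, by simp⟩
    have hlen' : (p.1 ++ s).length = (p.2 ++ t).length := by
      rw [List.length_append, List.length_append, hlen, hst]
    obtain ⟨s', hs'⟩ : ∃ s', y.pre m = p.1 ++ s ++ s' := exists_pre_eq_append hy hm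
    obtain ⟨t', ht'⟩ : ∃ t', z.pre m = p.2 ++ t ++ t' := exists_pre_eq_append hz (hlen' ▸ hm)
    have hsub : cyl (p.1 ++ (s ++ s')) ×ˢ cyl (p.2 ++ (t ++ t')) ⊆ D := by
      rw [← List.append_assoc, ← List.append_assoc, ← hs', ← ht']
      exact (Set.prod_mono (h₁ _ hm₁) (h₂ _ hm₂)).trans hUV
    have hys := y.pairwise_pre m
    have hzt := z.pairwise_pre m
    rw [hs', List.append_assoc] at hys
    rw [ht', List.append_assoc] at hzt
    have hss := (List.pairwise_append.1 hys).2.1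
    have htt := (List.pairwise_append.1 hzt).2.1
    have hl1 := congrArg List.length hs'
    have hl2 := congrArg List.length ht'
    rw [BBd.length_pre, List.length_append] at hl1 hl2
    refine ⟨s ++ s', t ++ t', ⟨q₀, List.mem_append_left _ hq₀, hq₀k⟩, by simp [ht0], ?_, hss, htt,
      above_of_append (List.ne_nil_of_mem hq₀) hsk hss, above_of_append ht0 htk htt, fun q hq => ?_⟩
    · rw [List.length_append, List.length_append]
      omega
    · rcases List.mem_cons.1 hq with rfl | hq
      · exact hsub
      · refine Subset.trans (Set.prod_mono ?_ ?_) (H q hq)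
        · rw [← List.append_assoc]
          exact cyl_append_subset _ _
        · rw [← List.append_assoc]
          exact cyl_append_subset _ _

/-- Successiveness constrains pairs of coordinates, hence is closed in a product of countable
discrete spaces. -/
instance instPolishSpaceBBd : PolishSpace (BBd b) := by
  have hcl : IsClosed {y : ℕ → RatBlock b | IsBlockSeq b fun n => (y n).1} := by
    simp only [isBlockSeq_iff, ofPred_forall]
    refine isClosed_iInter fun m => isClosed_iInter fun n => isClosed_iInter fun _ => ?_
    exact (isClosed_discrete {p : RatBlock b × RatBlock b | Before p.1 p.2}).preimage
      (f := fun y : ℕ → RatBlock b => (y m, y n)) (by fun_prop)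
  have : PolishSpace (RatBlock b) := inferInstance
  exact hcl.polishSpace

end Cylinders

/-! ### Residual sets and passing through finite block-sequences -/

section Passing

variable {𝕜 X : Type*} [RCLike 𝕜] [NormedAddCommGroup X] [NormedSpace 𝕜 X]
  {b : SchauderBasis 𝕜 X}

/-- The underlying vectors of a list of rational blocks. -/
def vectors (l : List (RatBlock b)) : List X := l.map fun q => q.1

theorem exists_vectors_eq {l : List X} (hl : ∀ x ∈ l, x ∈ ratBlocks b) :
    ∃ s : List (RatBlock b), vectors s = l := by
  induction l with
  | nil => exact ⟨[], rfl⟩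
  | cons x l ih =>
    obtain ⟨s, hs⟩ := ih fun y hy => hl y (List.mem_cons_of_mem _ hy)
    exact ⟨⟨x, hl x List.mem_cons_self⟩ :: s, congrArg (x :: ·) hs⟩

theorem length_vectors (l : List (RatBlock b)) : (vectors l).length = l.length := by
  simp [vectors]

theorem passesThrough_of_mem_cyl {p s : List (RatBlock b)} {y : BBd b} (hy : y ∈ cyl (p ++ s)) :
    PassesThrough y.seq (vectors s) := by
  refine ⟨p.length, fun i hi => ?_⟩
  rw [length_vectors] at hi
  rw [BBd.seq, mem_cyl_iff.1 hy _ (by rw [List.length_append]; omega),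
    List.getElem_append_right (by omega)]
  simp [vectors]

theorem exists_term_eq_of_passesThrough {s : List (RatBlock b)} {y : BBd b}
    (hy : PassesThrough y.seq (vectors s)) :
    ∃ m, ∀ (i : ℕ) (hi : i < s.length), y.1 (m + i) = s[i] := by
  obtain ⟨m, hm⟩ := hy
  refine ⟨m, fun i hi => Subtype.ext ((hm i (by rwa [length_vectors])).trans ?_)⟩
  simp [vectors]

theorem mem_cyl_pre_append {s : List (RatBlock b)} {y : BBd b} {m : ℕ}
    (h : ∀ (i : ℕ) (hi : i < s.length), y.1 (m + i) = s[i]) : y ∈ cyl (y.pre m ++ s) := by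
  rw [mem_cyl_iff]
  intro i hi
  rw [List.length_append, y.length_pre] at hi
  by_cases him : i < m
  · rw [List.getElem_append_left (by rwa [y.length_pre]), y.getElem_pre]
  · rw [List.getElem_append_right (by rw [y.length_pre]; omega)]
    simp only [y.length_pre]
    rw [← h (i - m) (by omega)]
    exact congrArg y.1 (by omega)

theorem mem_vectors {s : List (RatBlock b)} {q : RatBlock b} (hq : q ∈ s) : q.1 ∈ vectors s :=
  List.mem_map_of_mem hq

/-- Supports are nonempty and successive, so they escape to infinity; late lists can therefore be
appended to any finite block-sequence. -/
theorem above_of_isSuccessive {s : ℕ → List (RatBlock b)}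
    (hs : IsSuccessive b fun n => vectors (s n)) (n : ℕ) : Above n (s n) := by
  induction n with
  | zero => exact fun _ _ _ _ => Nat.zero_le _
  | succ n ih =>
    intro q hq j hj
    have hne : s n ≠ [] := fun h => (hs.1 n).1 (by simp [h, vectors])
    obtain ⟨p, hp⟩ := List.exists_mem_of_ne_nil _ hne
    obtain ⟨i, hi⟩ := p.supp_nonempty
    exact (ih p hp i hi).trans_lt
      (hs.2 n (n + 1) n.lt_succ_self p.1 (mem_vectors hp) q.1 (mem_vectors hq) i hi j hj)

/-- For each N, passing through some `u n` with n ≥ N depends on finitely many terms, hence is open,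
and can be arranged after any beginning, hence is dense. -/
theorem residual_passesThroughInf {u : ℕ → List X} (hu : IsSuccessive b u)
    (hQ : ∀ n, ∀ x ∈ u n, x ∈ ratBlocks b) :
    {y : BBd b | PassesThroughInf y.seq u} ∈ residual (BBd b) := by
  choose s hs using fun n => exists_vectors_eq (hQ n)
  obtain rfl : (fun n => vectors (s n)) = u := funext hs
  have hpair : ∀ n, (s n).Pairwise Before := fun n =>
    (List.pairwise_map.1 (hu.1 n).2.2 : (s n).Pairwise fun p q => SuppLT b p.1 q.1)
  have key : ∀ N : ℕ, {y : BBd b | ∃ n, N ≤ n ∧ PassesThrough y.seq (vectors (s n))} ∈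
      residual (BBd b) := by
    intro N
    refine residual_of_dense_open ?_ ?_
    · rw [isOpen_iff_mem_nhds]
      rintro y ⟨n, hn, hy⟩
      obtain ⟨m, hm⟩ := exists_term_eq_of_passesThrough hy
      filter_upwards [(isOpen_cyl _).mem_nhds (mem_cyl_pre_append hm)] with z hz
      exact ⟨n, hn, passesThrough_of_mem_cyl hz⟩
    · rw [dense_iff_inter_open]
      rintro V hV ⟨y, hy⟩
      obtain ⟨m, hm⟩ := exists_cyl_pre_subset hV hy
      obtain ⟨k, hk⟩ := exists_below (y.pre m)
      have hab := above_of_isSuccessive hu (max N k)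
      obtain ⟨z, hz⟩ := cyl_nonempty (pairwise_append (y.pairwise_pre m) (hpair (max N k))
        (hk.mono (le_max_right N k)) hab)
      exact ⟨z, hm m le_rfl (cyl_append_subset _ _ hz), _, le_max_left N k,
        passesThrough_of_mem_cyl hz⟩
  filter_upwards [countable_iInter_mem.2 key] with y hy
  refine infinite_of_forall_exists_gt fun N => ?_
  obtain ⟨n, hn, h⟩ := mem_iInter.1 hy (N + 1)
  exact ⟨n, h, hn⟩

/-- The support of a block bounds its position, so a tolerance chosen from the support alone serves
at every position the block can occupy. -/
theorem BBd.le_of_mem_supp (y : BBd b) (i : ℕ) : ∀ j ∈ supp b (y.1 i).1, i ≤ j := by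
  induction i with
  | zero => exact fun _ _ => Nat.zero_le _
  | succ i ih =>
    intro j hj
    obtain ⟨k, hk⟩ := (y.1 i).supp_nonempty
    exact (ih k hk).trans_lt (y.2.2 i (i + 1) i.lt_succ_self k hk j hj)

/-- A `Δ`-approximation of rational blocks by blocks with the same support, with finitely many
values on each finite interval. -/
theorem exists_approximation (b : SchauderBasis 𝕜 X) {Δ : ℕ → ℝ} (hΔ : ∀ n, 0 < Δ n) :
    ∃ a : RatBlock b → RatBlock b, (∀ q, supp b (a q).1 = supp b q.1) ∧
      (∀ q i, (∀ j ∈ supp b q.1, i ≤ j) → ‖(a q).1 - q.1‖ ≤ Δ i) ∧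
      ∀ k, {q | q ∈ range a ∧ ∀ i ∈ supp b q.1, i < k}.Finite := by
  have hε : ∀ S : Finset ℕ, ∃ ε > 0, ∀ i ≤ S.sup id, ε ≤ Δ i := by
    intro S
    have hne : (Finset.range (S.sup id + 1)).Nonempty := ⟨0, by simp⟩
    -- The least tolerance among the positions up to max S, which include all those open to a block
    -- with support S.
    refine ⟨(Finset.range (S.sup id + 1)).inf' hne Δ, (Finset.lt_inf'_iff hne).2 fun i _ => hΔ i,
      fun i hi => Finset.inf'_le _ (by simpa using Nat.lt_succ_of_le hi)⟩
  choose ε hε0 hε using hε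
  choose G hGf hGS hG using fun S : Finset ℕ => exists_finite_net b S (hε0 S)
  let σ : RatBlock b → Finset ℕ := fun q => q.supp_finite.toFinset
  have hσ : ∀ q, supp b q.1 = σ q := fun q => by simp [σ]
  choose a haG ha using fun q => hG (σ q) q (hσ q)
  have hsupp : ∀ q, supp b (a q).1 = supp b q.1 := fun q => by rw [hGS _ _ (haG q), ← hσ]
  refine ⟨a, hsupp, fun q i hi => (ha q).trans (hε _ i ?_), fun k => ?_⟩
  · obtain ⟨j, hj⟩ := q.supp_nonempty
    refine (hi j hj).trans (Finset.le_sup (f := id) ?_)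
    rw [hσ] at hj
    exact hj
  · refine ((Finset.range k).powerset.finite_toSet.biUnion fun S _ => hGf S).subset ?_
    rintro _ ⟨⟨q, rfl⟩, hq⟩
    refine mem_iUnion₂.2 ⟨σ q, ?_, haG q⟩
    rw [Finset.mem_coe, Finset.mem_powerset]
    intro i hi
    have : i ∈ supp b q.1 := by rw [hσ]; exact hi
    exact Finset.mem_range.2 (hq i (by rwa [hsupp]))

theorem length_le_of_below {k : ℕ} {p : List (RatBlock b)} (hp : p.Pairwise Before)
    (hk : Below k p) : p.length ≤ k := by
  obtain ⟨y, hy⟩ := cyl_nonempty hp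
  by_contra h
  have hlt : k < p.length := not_le.1 h
  obtain ⟨j, hj⟩ := (y.1 k).supp_nonempty
  have h1 := y.le_of_mem_supp k j hj
  rw [mem_cyl_iff.1 hy k hlt] at hj
  exact absurd (hk _ (List.getElem_mem hlt) j hj) (by omega)

theorem finite_setOf_below {F : Set (RatBlock b)} (hF : F.Finite) (k : ℕ) :
    {p : List (RatBlock b) | p.Pairwise Before ∧ Below k p ∧ ∀ q ∈ p, q ∈ F}.Finite := by
  have := hF.to_subtype
  refine ((List.finite_length_le F k).image (List.map Subtype.val)).subset ?_
  rintro p ⟨hp, hk, hpF⟩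
  refine ⟨p.attach.map fun q => ⟨q.1, hpF q.1 q.2⟩, ?_, by simp [Function.comp_def]⟩
  simpa using length_le_of_below hp hk

theorem Before.irrefl (q : RatBlock b) : ¬ Before q q := fun h => by
  obtain ⟨i, hi⟩ := q.supp_nonempty
  exact lt_irrefl _ (h i hi i hi)

/-- Each new list s must force `D n` after every possible beginning. If terms outside the chosen
lists are rounded by the approximation `a`, only finitely many beginnings lie before s. Rounding an
arbitrary y that passes through infinitely many lists, but keeping the terms of the lists, gives an
element of A within Δ of y. -/
theorem exists_isSuccessive_of_residual {A : Set (BBd b)} (hA : A ∈ residual (BBd b))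
    {Δ : ℕ → ℝ} (hΔ : ∀ n, 0 < Δ n) :
    ∃ u : ℕ → List X, IsSuccessive b u ∧ (∀ n, ∀ x ∈ u n, x ∈ ratBlocks b) ∧
      ∀ y : BBd b, PassesThroughInf y.seq u → y ∈ expansion A Δ := by
  obtain ⟨D, hDanti, hDo, hDd, hDA⟩ := exists_antitone_dense_open hA
  obtain ⟨a, hasupp, haΔ, hafin⟩ := exists_approximation b hΔ
  have step : ∀ (n : ℕ) (W : List (RatBlock b)), ∃ s : List (RatBlock b), s ≠ [] ∧
      s.Pairwise Before ∧ (∀ x ∈ W, ∀ q ∈ s, Before x q) ∧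
      ∀ p : List (RatBlock b), p.Pairwise Before → (∀ x ∈ p, x ∈ W ∨ x ∈ range a) →
        (∀ x ∈ p, ∀ q ∈ s, Before x q) → cyl (p ++ s) ⊆ D n := by
    intro n W
    obtain ⟨k, hk⟩ := exists_below W
    let P := {p : List (RatBlock b) | p.Pairwise Before ∧ Below k p ∧
      ∀ q ∈ p, q ∈ {q | q ∈ W} ∪ {q | q ∈ range a ∧ ∀ i ∈ supp b q.1, i < k}}
    have hP : P.Finite := finite_setOf_below ((List.finite_toSet W).union (hafin k)) k
    -- Only one coordinate matters here; the second factor is the whole space.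
    obtain ⟨s, t, ⟨q₀, hq₀, hq₀k⟩, -, -, hs, ht, hsk, htk, hsD⟩ :=
      exists_simultaneous_extension ((hDo n).prod isOpen_univ) ((hDd n).prod dense_univ) k
        (hP.toFinset.toList.map fun p => (p, p)) (by
          intro pq hpq
          obtain ⟨p, hp, rfl⟩ := List.mem_map.1 hpq
          have hpP : p ∈ P := by simpa using hp
          exact ⟨hpP.1, hpP.1, rfl, hpP.2.1, hpP.2.1⟩)
    refine ⟨s, List.ne_nil_of_mem hq₀, hs, fun x hx q hq i hi j hj =>
      (hk x hx i hi).trans_le (hsk q hq j hj), fun p hp hpW hps y hy => ?_⟩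
    have hpk : Below k p := fun x hx i hi => hps x hx q₀ hq₀ i hi k hq₀k
    have hpP : p ∈ P := ⟨hp, hpk, fun x hx => (hpW x hx).imp id fun h => ⟨h, hpk x hx⟩⟩
    obtain ⟨z, hz⟩ := cyl_nonempty (pairwise_append hp ht hpk htk)
    have hmem : (p, p) ∈ hP.toFinset.toList.map fun p => (p, p) :=
      List.mem_map_of_mem (by simpa using hpP)
    exact (hsD (p, p) hmem (mk_mem_prod hy hz)).1
  choose s hs0 hs hsW hsD using step
  let W : ℕ → List (RatBlock b) := fun n => Nat.rec [] (fun n w => w ++ s n w) n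
  have hW : ∀ n, W (n + 1) = W n ++ s n (W n) := fun n => rfl
  let v : ℕ → List (RatBlock b) := fun n => s n (W n)
  have hWv : ∀ m n, m < n → ∀ q ∈ v m, q ∈ W n := by
    intro m n hmn q hq
    induction n, hmn using Nat.le_induction with
    | base => rw [Nat.succ_eq_add_one, hW]; exact List.mem_append_right _ hq
    | succ n _ ih => rw [hW]; exact List.mem_append_left _ ih
  have hvv : ∀ m n, m < n → ∀ p ∈ v m, ∀ q ∈ v n, Before p q := fun m n hmn p hp q hq =>
    hsW n (W n) p (hWv m n hmn p hp) q hq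
  refine ⟨fun n => vectors (v n), ⟨fun n => ⟨?_, ?_, ?_⟩, ?_⟩, ?_, fun y hy => ?_⟩
  · simpa [vectors] using hs0 n (W n)
  · intro x hx
    obtain ⟨q, -, rfl⟩ := List.mem_map.1 hx
    exact isBlock_of_mem_ratBlocks q.2
  · exact List.pairwise_map.2 (hs n (W n))
  · intro m n hmn x hx z hz
    obtain ⟨p, hp, rfl⟩ := List.mem_map.1 hx
    obtain ⟨q, hq, rfl⟩ := List.mem_map.1 hz
    exact hvv m n hmn p hp q hq
  · intro n x hx
    obtain ⟨q, -, rfl⟩ := List.mem_map.1 hx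
    exact q.2
  classical
  let c : RatBlock b → RatBlock b := fun q => if ∃ n, q ∈ v n then q else a q
  have hc : ∀ q, supp b (c q).1 = supp b q.1 := fun q => by
    by_cases h : ∃ n, q ∈ v n
    · simp only [c, if_pos h]
    · simp only [c, if_neg h, hasupp]
  let z : BBd b := ⟨fun n => c (y.1 n), (isBlockSeq_iff _).2 fun m n hmn i hi j hj => by
    rw [hc] at hi hj
    exact y.2.2 m n hmn i hi j hj⟩
  refine ⟨z, hDA (mem_iInter.2 fun m => ?_), fun n => ?_⟩
  · obtain ⟨n, hn, hmn⟩ := hy.exists_gt m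
    refine hDanti hmn.le ?_
    obtain ⟨j, hj⟩ := exists_term_eq_of_passesThrough hn
    have hz : ∀ (i : ℕ) (hi : i < (v n).length), z.1 (j + i) = (v n)[i] := by
      intro i hi
      change c (y.1 (j + i)) = _
      rw [hj i hi]
      exact if_pos ⟨n, List.getElem_mem hi⟩
    have hbefore : ∀ i < j, ∀ q ∈ v n, Before (y.1 i) q := by
      intro i hi q hq
      obtain ⟨i', hi', rfl⟩ := List.mem_iff_getElem.1 hq
      rw [← hj i' hi']
      exact y.2.2 _ _ (by omega)
    refine hsD n (W n) (z.pre j) (z.pairwise_pre j) ?_ ?_ (mem_cyl_pre_append hz)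
    · intro x hx
      obtain ⟨i, hi, rfl⟩ := List.mem_map.1 hx
      have hij : i < j := by simpa using hi
      change c (y.1 i) ∈ W n ∨ c (y.1 i) ∈ range a
      by_cases h : ∃ n, y.1 i ∈ v n
      · left
        have hci : c (y.1 i) = y.1 i := if_pos h
        rw [hci]
        obtain ⟨n', hn'⟩ := h
        -- A list term met before the occurrence of `v n` in y must come from an earlier list, since
        -- y is successive.
        rcases lt_trichotomy n' n with hlt | rfl | hlt
        · exact hWv n' n hlt _ hn'
        · exact absurd (hbefore i hij _ hn') (Before.irrefl _)
        · obtain ⟨q, hq⟩ := List.exists_mem_of_ne_nil _ (hs0 n (W n))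
          exact absurd ((hbefore i hij q hq).trans (hvv n n' hlt q hq _ hn')) (Before.irrefl _)
      · right
        exact ⟨y.1 i, (if_neg h).symm⟩
    · intro x hx q hq
      obtain ⟨i, hi, rfl⟩ := List.mem_map.1 hx
      intro k hk
      have hk' : k ∈ supp b (c (y.1 i)).1 := hk
      rw [hc] at hk'
      exact hbefore i (by simpa using hi) q hq k hk'
  · change ‖(c (y.1 n)).1 - (y.1 n).1‖ ≤ Δ n
    by_cases h : ∃ m, y.1 n ∈ v m
    · have hcn : c (y.1 n) = y.1 n := if_pos h
      rw [hcn, sub_self, norm_zero]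
      exact (hΔ n).le
    · have hcn : c (y.1 n) = a (y.1 n) := if_neg h
      rw [hcn]
      exact haΔ _ _ (y.le_of_mem_supp n)

/-- For Δ as in the perturbation principle, the class contains its own expansion. -/
theorem isoClass_mem_residual_iff [CompleteSpace X] (x : BBd b) :
    isoClass x ∈ residual (BBd b) ↔ ∃ u : ℕ → List X, IsSuccessive b u ∧
      (∀ n, ∀ v ∈ u n, v ∈ ratBlocks b) ∧
      ∀ y : BBd b, PassesThroughInf y.seq u → y ∈ isoClass x := by
  constructor
  · intro h
    obtain ⟨δ, hδ, H⟩ := exists_perturbation_bound b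
    obtain ⟨u, hu, hQ, hA⟩ := exists_isSuccessive_of_residual h hδ
    refine ⟨u, hu, hQ, fun y hy => ?_⟩
    obtain ⟨z, hz, hzy⟩ := hA y hy
    exact (H y.seq z.seq y.isBlockSeq y.norm_seq fun n =>
      (hzy n).trans (by linarith [hδ n])).isomorphic.trans hz
  · rintro ⟨u, hu, hQ, hA⟩
    filter_upwards [residual_passesThroughInf hu hQ] with y hy
    exact hA y hy

end Passing

/-! ### Isomorphism of closed spans is analytic -/

section Analytic

variable {𝕜 X : Type*} [RCLike 𝕜] [NormedAddCommGroup X] [NormedSpace 𝕜 X]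
  {b : SchauderBasis 𝕜 X}

theorem separableSpace_of_schauderBasis (b : SchauderBasis 𝕜 X) :
    TopologicalSpace.SeparableSpace X := by
  have h1 : TopologicalSpace.IsSeparable (Submodule.span 𝕜 (range b) : Set X) :=
    (countable_range b).isSeparable.span
  have h2 : Dense (Submodule.span 𝕜 (range b) : Set X) := by
    intro x
    refine mem_closure_of_tendsto (b.tendsto_proj x) (.of_forall fun n => ?_)
    rw [SchauderBasis.proj_apply]
    exact Submodule.sum_mem _ fun i _ =>
      Submodule.smul_mem _ _ (Submodule.subset_span (mem_range_self i))
  have := h1.closure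
  rwa [h2.closure_eq, TopologicalSpace.isSeparable_univ_iff] at this

theorem continuous_linearCombination (a : ℕ →₀ 𝕜) :
    Continuous fun w : ℕ → X => Finsupp.linearCombination 𝕜 w a := by
  simp only [Finsupp.linearCombination_apply, Finsupp.sum]
  fun_prop

theorem continuous_seq : Continuous (BBd.seq : BBd b → ℕ → X) :=
  continuous_pi fun n =>
    (continuous_of_discreteTopology (f := fun q : RatBlock b => q.1)).comp (continuous_term n)

theorem mem_closedSpan_iff {w : ℕ → X} {v : X} :
    v ∈ closedSpan 𝕜 w ↔
      ∀ k : ℕ, ∃ a : ℕ →₀ 𝕜, ‖v - Finsupp.linearCombination 𝕜 w a‖ < 1 / ((k : ℝ) + 1) := by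
  have h : v ∈ closedSpan 𝕜 w ↔ v ∈ closure (Submodule.span 𝕜 (range w) : Set X) := Iff.rfl
  rw [h, Metric.mem_closure_iff]
  constructor
  · intro H k
    obtain ⟨u, hu, hv⟩ := H _ (Nat.one_div_pos_of_nat (n := k))
    obtain ⟨a, rfl⟩ := Finsupp.mem_span_range_iff_exists_finsupp.1 hu
    exact ⟨a, by rwa [dist_eq_norm] at hv⟩
  · intro H ε hε
    obtain ⟨k, hk⟩ := exists_nat_one_div_lt hε
    obtain ⟨a, ha⟩ := H k
    refine ⟨Finsupp.linearCombination 𝕜 w a,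
      Finsupp.mem_span_range_iff_exists_finsupp.2 ⟨a, rfl⟩, ?_⟩
    rw [dist_eq_norm]
    exact ha.trans hk

/-- Being within 1/(k+1) of some finite combination is an open condition, a union over all
coefficient families. -/
theorem isGδ_mem_closedSpan (𝕜 : Type*) [RCLike 𝕜] [NormedSpace 𝕜 X] {Z : Type*}
    [TopologicalSpace Z] {v : Z → X} {w : Z → ℕ → X} (hv : Continuous v) (hw : Continuous w) :
    IsGδ {p | v p ∈ closedSpan 𝕜 (w p)} := by
  have : {p | v p ∈ closedSpan 𝕜 (w p)} = ⋂ k : ℕ, ⋃ a : ℕ →₀ 𝕜,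
      {p | ‖v p - Finsupp.linearCombination 𝕜 (w p) a‖ < 1 / ((k : ℝ) + 1)} := by
    ext p
    simp only [mem_ofPred_eq, mem_closedSpan_iff, mem_iInter, mem_iUnion]
  rw [this]
  refine .iInter_of_isOpen fun k => isOpen_iUnion fun a => ?_
  exact isOpen_lt (hv.sub ((continuous_linearCombination a).comp hw)).norm continuous_const

/-- The triples `((x, y), w)` such that `x` and `w` are `C`-equivalent and `[w] = [y]`. -/
def isoWitness (b : SchauderBasis 𝕜 X) (C : ℝ) : Set ((BBd b × BBd b) × (ℕ → X)) :=
  {p | (∀ a : ℕ →₀ 𝕜, ‖Finsupp.linearCombination 𝕜 p.2 a‖ ≤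
        C * ‖Finsupp.linearCombination 𝕜 p.1.1.seq a‖) ∧
      (∀ a : ℕ →₀ 𝕜, ‖Finsupp.linearCombination 𝕜 p.1.1.seq a‖ ≤
        C * ‖Finsupp.linearCombination 𝕜 p.2 a‖) ∧
      (∀ n, p.2 n ∈ closedSpan 𝕜 p.1.2.seq) ∧ ∀ n, p.1.2.seq n ∈ closedSpan 𝕜 p.2}

/-- Isomorphisms are coded by the images w of the generators, which range over the Polish space of
sequences in X. The norm comparisons are closed and the span conditions Gδ, so the coded set is
Borel and its projection analytic. -/
theorem analyticSet_image_isoWitness [CompleteSpace X] (b : SchauderBasis 𝕜 X) (C : ℝ) :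
    MeasureTheory.AnalyticSet (Prod.fst '' isoWitness b C) := by
  have := separableSpace_of_schauderBasis b
  have hx : Continuous fun p : (BBd b × BBd b) × (ℕ → X) => p.1.1.seq :=
    continuous_seq.comp (continuous_fst.comp continuous_fst)
  have hy : Continuous fun p : (BBd b × BBd b) × (ℕ → X) => p.1.2.seq :=
    continuous_seq.comp (continuous_snd.comp continuous_fst)
  have hw : Continuous fun p : (BBd b × BBd b) × (ℕ → X) => p.2 := continuous_snd
  have hlx := fun a : ℕ →₀ 𝕜 => ((continuous_linearCombination a).comp hx).norm
  have hlw := fun a : ℕ →₀ 𝕜 => ((continuous_linearCombination a).comp hw).norm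
  have key : IsGδ (isoWitness b C) := by
    simp only [isoWitness, ofPred_and, ofPred_forall]
    refine .inter ?_ (.inter ?_ (.inter ?_ ?_))
    · exact (isClosed_iInter fun a =>
        isClosed_le (hlw a) (continuous_const.mul (hlx a))).isGδ
    · exact (isClosed_iInter fun a =>
        isClosed_le (hlx a) (continuous_const.mul (hlw a))).isGδ
    · exact .iInter fun n => isGδ_mem_closedSpan 𝕜 ((continuous_apply n).comp hw) hy
    · exact .iInter fun n => isGδ_mem_closedSpan 𝕜 ((continuous_apply n).comp hy) hw
  borelize ((BBd b × BBd b) × (ℕ → X))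
  exact key.measurableSet.analyticSet.image_of_continuous continuous_fst

theorem bddIso_of_mem_image_isoWitness [CompleteSpace X] {C : ℝ} (hC : 0 ≤ C)
    {x y : BBd b} (h : (x, y) ∈ Prod.fst '' isoWitness b C) :
    BddIso C (closedSpan 𝕜 x.seq) (closedSpan 𝕜 y.seq) := by
  obtain ⟨⟨⟨x', y'⟩, w⟩, ⟨h1, h2, h3, h4⟩, he⟩ := h
  obtain ⟨rfl, rfl⟩ := Prod.mk_inj.1 he
  have : closedSpan 𝕜 w = closedSpan 𝕜 y'.seq :=
    le_antisymm (closedSpan_le (isClosed_closedSpan _) h3)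
      (closedSpan_le (isClosed_closedSpan _) h4)
  rw [← this]
  exact bddIso_of_norm_linearCombination_le hC h1 h2

theorem exists_mem_image_isoWitness {x y : BBd b}
    (h : Isomorphic (closedSpan 𝕜 x.seq) (closedSpan 𝕜 y.seq)) :
    ∃ C : ℕ, (x, y) ∈ Prod.fst '' isoWitness b C := by
  obtain ⟨T⟩ := h
  obtain ⟨C, hC⟩ := exists_nat_ge (max ‖(T : closedSpan 𝕜 x.seq →L[𝕜] closedSpan 𝕜 y.seq)‖
    ‖(T.symm : closedSpan 𝕜 y.seq →L[𝕜] closedSpan 𝕜 x.seq)‖)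
  let x' : ℕ → closedSpan 𝕜 x.seq := fun n => ⟨x.seq n, mem_closedSpan _ n⟩
  let w : ℕ → X := fun n => (T (x' n) : X)
  have hlx : ∀ a : ℕ →₀ 𝕜, Finsupp.linearCombination 𝕜 x.seq a =
      (Finsupp.linearCombination 𝕜 x' a : closedSpan 𝕜 x.seq) := by
    intro a
    simp [Finsupp.linearCombination_apply, Finsupp.sum, x']
  have hlw : ∀ a : ℕ →₀ 𝕜, Finsupp.linearCombination 𝕜 w a =
      (T (Finsupp.linearCombination 𝕜 x' a) : closedSpan 𝕜 y.seq) := by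
    intro a
    simp [Finsupp.linearCombination_apply, Finsupp.sum, w]
  refine ⟨C, ((x, y), w), ⟨fun a => ?_, fun a => ?_, fun n => (T (x' n)).2, fun n => ?_⟩, rfl⟩
  · change ‖Finsupp.linearCombination 𝕜 w a‖ ≤ C * ‖Finsupp.linearCombination 𝕜 x.seq a‖
    rw [hlx, hlw]
    exact (T : closedSpan 𝕜 x.seq →L[𝕜] closedSpan 𝕜 y.seq).le_of_opNorm_le
      ((le_max_left _ _).trans hC) _
  · change ‖Finsupp.linearCombination 𝕜 x.seq a‖ ≤ C * ‖Finsupp.linearCombination 𝕜 w a‖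
    rw [hlx, hlw]
    have := (T.symm : closedSpan 𝕜 y.seq →L[𝕜] closedSpan 𝕜 x.seq).le_of_opNorm_le
      ((le_max_right _ _).trans hC) (T (Finsupp.linearCombination 𝕜 x' a))
    simpa using this
  · change y.seq n ∈ closedSpan 𝕜 w
    let y' : closedSpan 𝕜 y.seq := ⟨y.seq n, mem_closedSpan _ n⟩
    -- The vectors of [x] that T maps into [w] form a closed subspace containing the generators, so
    -- T has its range, namely [y], inside [w].
    have hle : closedSpan 𝕜 x.seq ≤ ((closedSpan 𝕜 w).comap ((closedSpan 𝕜 y.seq).subtype ∘ₗ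
        (T : closedSpan 𝕜 x.seq →ₗ[𝕜] closedSpan 𝕜 y.seq))).map (closedSpan 𝕜 x.seq).subtype := by
      refine closedSpan_le ?_ fun m => ⟨x' m, mem_closedSpan w m, rfl⟩
      rw [Submodule.map_coe]
      exact (isClosed_closedSpan x.seq).isClosedEmbedding_subtypeVal.isClosedMap _
        ((isClosed_closedSpan w).preimage (continuous_subtype_val.comp T.continuous))
    obtain ⟨v, hv, hvy⟩ := hle (T.symm y').2
    have hv' : v = T.symm y' := Subtype.ext hvy
    subst hv'
    have h2 : ((T (T.symm y') : closedSpan 𝕜 y.seq) : X) ∈ closedSpan 𝕜 w := hv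
    rwa [T.apply_symm_apply] at h2

end Analytic

/-! ### The reduction of `E0` -/

section Reduction

variable {𝕜 X : Type*} [RCLike 𝕜] [NormedAddCommGroup X] [NormedSpace 𝕜 X]
  {b : SchauderBasis 𝕜 X}

/-- A residual set of pairs contains all `(φ α, φ β)` with `α`, `β` not `E0`-equivalent, for some
continuous `φ` which preserves eventual agreement. -/
theorem exists_continuous_E0 {R : Set (BBd b × BBd b)} (hR : R ∈ residual (BBd b × BBd b)) :
    ∃ φ : (ℕ → Bool) → BBd b, Continuous φ ∧
      (∀ α β, E0 α β → ∃ N, ∀ i, N ≤ i → (φ α).1 i = (φ β).1 i) ∧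
      ∀ α β, ¬ E0 α β → (φ α, φ β) ∈ R := by
  obtain ⟨D, hDanti, hDo, hDd, hDR⟩ := exists_antitone_dense_open hR
  -- The state at stage n contains the beginnings attached to all binary words of length n. Their
  -- common length keeps later terms at the same positions.
  let State := {P : Set (List (RatBlock b)) // P.Finite ∧
    ∃ N, ∀ p ∈ P, p.Pairwise Before ∧ p.length = N}
  have step : ∀ (n : ℕ) (P : State), ∃ s : Bool → List (RatBlock b), (∀ c, s c ≠ []) ∧
      (s false).length = (s true).length ∧ (∀ p ∈ P.1, ∀ c, (p ++ s c).Pairwise Before) ∧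
      ∀ p ∈ P.1, ∀ q ∈ P.1, ∀ c c', c ≠ c' → cyl (p ++ s c) ×ˢ cyl (q ++ s c') ⊆ D n := by
    rintro n ⟨P, hP, N, hN⟩
    obtain ⟨k, hk⟩ := exists_below_of_finite hP
    -- Intersecting with the swapped set handles both orders of the two branches at once.
    have hso : IsOpen (Prod.swap ⁻¹' D n) := (hDo n).preimage continuous_swap
    have hsd : Dense (Prod.swap ⁻¹' D n) :=
      (hDd n).preimage (Homeomorph.prodComm (BBd b) (BBd b)).isOpenMap
    obtain ⟨s, t, ⟨q₀, hq₀, -⟩, ht0, hst, hs, ht, hsk, htk, hD⟩ :=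
      exists_simultaneous_extension ((hDo n).inter hso)
        ((hDd n).inter_of_isOpen_left hsd (hDo n)) k (hP.prod hP).toFinset.toList (by
          rintro ⟨p, q⟩ hpq
          have hpq' : p ∈ P ∧ q ∈ P := by simpa using hpq
          exact ⟨(hN p hpq'.1).1, (hN q hpq'.2).1, (hN p hpq'.1).2.trans (hN q hpq'.2).2.symm,
            hk p hpq'.1, hk q hpq'.2⟩)
    refine ⟨fun c => bif c then t else s, ?_, hst, ?_, ?_⟩
    · rintro (_ | _)
      · exact List.ne_nil_of_mem hq₀
      · exact ht0
    · rintro p hp (_ | _)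
      · exact pairwise_append (hN p hp).1 hs (hk p hp) hsk
      · exact pairwise_append (hN p hp).1 ht (hk p hp) htk
    · have hD' : ∀ p ∈ P, ∀ q ∈ P, cyl (p ++ s) ×ˢ cyl (q ++ t) ⊆ D n ∩ Prod.swap ⁻¹' D n :=
        fun p hp q hq => hD (p, q) (by simpa using ⟨hp, hq⟩)
      rintro p hp q hq (_ | _) (_ | _) hc
      · exact absurd rfl hc
      · exact (hD' p hp q hq).trans inter_subset_left
      · rintro ⟨y, z⟩ ⟨hy, hz⟩
        exact (hD' q hq p hp (mk_mem_prod hz hy)).2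
      · exact absurd rfl hc
  choose s hs0 hslen hsP hsD using step
  have hlen : ∀ n P c, (s n P c).length = (s n P true).length := by
    rintro n P (_ | _)
    · exact hslen n P
    · rfl
  let next : ℕ → State → State := fun n P =>
    ⟨⋃ c : Bool, (fun p => p ++ s n P c) '' P.1, finite_iUnion fun c => P.2.1.image _, by
      obtain ⟨N, hN⟩ := P.2.2
      refine ⟨N + (s n P true).length, fun r hr => ?_⟩
      obtain ⟨c, p, hp, rfl⟩ := mem_iUnion.1 hr
      exact ⟨hsP n P p hp c, by rw [List.length_append, (hN p hp).2, hlen]⟩⟩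
  let S : ℕ → State := fun n => Nat.rec ⟨{[]}, finite_singleton _, 0, by simp⟩ next n
  have hS : ∀ n, S (n + 1) = next n (S n) := fun n => rfl
  let w : ℕ → Bool → List (RatBlock b) := fun n => s n (S n)
  let p : (ℕ → Bool) → ℕ → List (RatBlock b) := fun α n =>
    Nat.rec [] (fun n l => l ++ w n (α n)) n
  have hp : ∀ α n, p α (n + 1) = p α n ++ w n (α n) := fun α n => rfl
  have hpS : ∀ α n, p α n ∈ (S n).1 := by
    intro α n
    induction n with
    | zero => exact mem_singleton _
    | succ n ih => exact mem_iUnion.2 ⟨α n, p α n, ih, rfl⟩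
  have hpw : ∀ α n, (p α n).Pairwise Before := fun α n => by
    obtain ⟨N, hN⟩ := (S n).2.2
    exact (hN _ (hpS α n)).1
  have hplen : ∀ α β n, (p α n).length = (p β n).length := fun α β n => by
    obtain ⟨N, hN⟩ := (S n).2.2
    rw [(hN _ (hpS α n)).2, (hN _ (hpS β n)).2]
  have hple : ∀ α n, n ≤ (p α n).length := by
    intro α n
    induction n with
    | zero => exact Nat.zero_le _
    | succ n ih =>
      rw [hp, List.length_append]
      have := List.length_pos_iff.2 (hs0 n (S n) (α n))
      change n + 1 ≤ _ + (s n (S n) (α n)).length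
      omega
  have hpref : ∀ α m n, m ≤ n → p α m <+: p α n := by
    intro α m n hmn
    induction n, hmn using Nat.le_induction with
    | base => exact List.prefix_rfl
    | succ n _ ih => exact ih.trans (List.prefix_append _ _)
  let g : (ℕ → Bool) → ℕ → RatBlock b := fun α i =>
    (p α (i + 1))[i]'(hple α (i + 1))
  have hg : ∀ α n i (hi : i < (p α n).length), g α i = (p α n)[i] := by
    intro α n i hi
    rcases le_total n (i + 1) with h | h
    · exact ((hpref α _ _ h).getElem hi).symm
    · exact (hpref α _ _ h).getElem (hple α (i + 1))
  have hgb : ∀ α, IsBlockSeq b fun n => (g α n).1 := by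
    intro α
    rw [isBlockSeq_iff]
    intro m n hmn
    rw [hg α (n + 1) m (by have := hple α (n + 1); omega), hg α (n + 1) n (hple α (n + 1))]
    exact List.pairwise_iff_getElem.1 (hpw α (n + 1)) m n _ _ hmn
  have hgcyl : ∀ α n, (⟨g α, hgb α⟩ : BBd b) ∈ cyl (p α n) := fun α n =>
    mem_cyl_iff.2 fun i hi => hg α n i hi
  refine ⟨fun α => ⟨g α, hgb α⟩, ?_, ?_, ?_⟩
  · refine Continuous.subtype_mk (continuous_pi fun i => ?_) _
    have hloc : ∀ n, IsLocallyConstant fun α => p α n := by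
      intro n
      induction n with
      | zero => exact .const _
      | succ n ih =>
        have h2 : IsLocallyConstant fun α : ℕ → Bool => α n :=
          (IsLocallyConstant.iff_continuous _).2 (continuous_apply n)
        exact (ih.prodMk h2).comp fun q => q.1 ++ w n q.2
    -- The default value is never used, as `p α (i + 1)` has length greater than i. Each coordinate
    -- is thus a function of a locally constant list.
    have h3 : (fun α => g α i) = (fun l : List (RatBlock b) =>
        (l[i]?).getD (g (fun _ => false) i)) ∘ fun α => p α (i + 1) := by
      funext α
      have hi : i < (p α (i + 1)).length := hple α (i + 1)
      simp only [Function.comp_apply, List.getElem?_eq_getElem hi, Option.getD_some]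
      rfl
    rw [h3]
    exact ((hloc (i + 1)).comp _).continuous
  · rintro α β ⟨n, hn⟩
    refine ⟨(p α n).length, fun i hi => ?_⟩
    have key : ∀ m, n ≤ m → ∃ r, p α m = p α n ++ r ∧ p β m = p β n ++ r := by
      intro m hm
      induction m, hm using Nat.le_induction with
      | base => exact ⟨[], by simp, by simp⟩
      | succ m hm ih =>
        obtain ⟨r, h1, h2⟩ := ih
        refine ⟨r ++ w m (α m), ?_, ?_⟩
        · rw [hp, h1, List.append_assoc]
        · rw [hp, h2, List.append_assoc, hn m hm]
    obtain ⟨r, h1, h2⟩ := key (max n (i + 1)) (le_max_left _ _)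
    have hl := hplen α β n
    have hi1 : i < (p α (max n (i + 1))).length :=
      (lt_of_lt_of_le (Nat.lt_succ_self i) (le_max_right n (i + 1))).trans_le (hple α _)
    have hi2 : i < (p β (max n (i + 1))).length := hplen α β _ ▸ hi1
    change g α i = g β i
    rw [hg α _ i hi1, hg β _ i hi2]
    simp only [h1, h2]
    rw [List.getElem_append_right hi, List.getElem_append_right (hl ▸ hi)]
    simp only [hl]
  · intro α β hαβ
    refine hDR (mem_iInter.2 fun m => ?_)
    -- One disagreement at a stage n ≥ m suffices, because stage n treated all pairs of beginnings,
    -- whatever their past.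
    obtain ⟨n, hmn, hn⟩ : ∃ n, m ≤ n ∧ α n ≠ β n := by
      by_contra! h
      exact hαβ ⟨m, h⟩
    refine hDanti hmn (hsD n (S n) (p α n) (hpS α n) (p β n) (hpS β n) _ _ hn ?_)
    exact mk_mem_prod (hgcyl α (n + 1)) (hgcyl β (n + 1))

/-- The reduction is α ↦ [φ α], with φ built for the complement of the isomorphism relation;
eventual agreement gives isomorphic spans. -/
theorem isErgodic_of_isMeagre [CompleteSpace X] (b : SchauderBasis 𝕜 X)
    (h : IsMeagre {p : BBd b × BBd b |
      Isomorphic (closedSpan 𝕜 p.1.seq) (closedSpan 𝕜 p.2.seq)}) : IsErgodic 𝕜 X := by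
  obtain ⟨φ, hφ, hE, hnE⟩ := exists_continuous_E0 h
  let F : (ℕ → Bool) → ClosedSubmodule 𝕜 X := fun α =>
    ⟨closedSpan 𝕜 (φ α).seq, isClosed_closedSpan _⟩
  refine ⟨F, ?_, fun α β => ⟨fun hαβ => ?_, fun hiso => ?_⟩⟩
  · refine @measurable_generateFrom _ _ (borel _) _ _ ?_
    rintro _ ⟨U, hU, rfl⟩
    apply MeasurableSpace.measurableSet_generateFrom
    -- A closed span meets an open set exactly when some finite combination lies in it, so this
    -- preimage is even open.
    have : F ⁻¹' {G | ((G : Set X) ∩ U).Nonempty} =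
        ⋃ a : ℕ →₀ 𝕜, {α | Finsupp.linearCombination 𝕜 (φ α).seq a ∈ U} := by
      ext α
      simp only [mem_iUnion, mem_ofPred_eq, mem_preimage]
      constructor
      · rintro ⟨v, hv, hvU⟩
        have hv' : v ∈ closure (Submodule.span 𝕜 (range (φ α).seq) : Set X) := hv
        obtain ⟨u, huU, hu⟩ := mem_closure_iff.1 hv' U hU hvU
        obtain ⟨a, rfl⟩ := Finsupp.mem_span_range_iff_exists_finsupp.1 hu
        exact ⟨a, huU⟩
      · rintro ⟨a, ha⟩
        exact ⟨_, Submodule.le_topologicalClosure _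
          (Finsupp.mem_span_range_iff_exists_finsupp.2 ⟨a, rfl⟩), ha⟩
    rw [this]
    exact isOpen_iUnion fun a =>
      hU.preimage ((continuous_linearCombination a).comp (continuous_seq.comp hφ))
  · obtain ⟨N, hN⟩ := hE α β hαβ
    obtain ⟨K, hK⟩ := exists_bddIso_of_eventuallyEq b N
    exact (hK (φ α).seq (φ β).seq (φ α).isBlockSeq (φ α).norm_seq (φ β).isBlockSeq
      (φ β).norm_seq fun n hn => congrArg Subtype.val (hN n hn)).isomorphic
  · by_contra hαβ
    exact hnE α β hαβ hiso

end Reduction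

/-! ### The dichotomy -/

section Dichotomy

variable {𝕜 X : Type*} [RCLike 𝕜] [NormedAddCommGroup X] [NormedSpace 𝕜 X]
  {b : SchauderBasis 𝕜 X}

/-- If `s` starts a block-sequence with supports below `|s| + d`, then any block-sequence may be
changed so that it starts with `s`, skipping `d` terms. The change is open and continuous. -/
theorem exists_openMap_cyl {s : List (RatBlock b)} (hs : s.Pairwise Before) {d : ℕ}
    (hd : Below (s.length + d) s) :
    ∃ θ : BBd b → BBd b, Continuous θ ∧ IsOpenMap θ ∧ (∀ y, θ y ∈ cyl s) ∧
      ∀ y i, s.length ≤ i → (θ y).1 i = y.1 (i + d) := by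
  -- Skipping d terms makes room: the term of index |s| + d or more is supported in [|s| + d, ∞),
  -- beyond s.
  let g : BBd b → ℕ → RatBlock b := fun y i => if h : i < s.length then s[i] else y.1 (i + d)
  have hg1 : ∀ y i (h : i < s.length), g y i = s[i] := fun y i h => dif_pos h
  have hg2 : ∀ y i, s.length ≤ i → g y i = y.1 (i + d) := fun y i h => dif_neg (not_lt.2 h)
  have hgb : ∀ y, IsBlockSeq b fun n => (g y n).1 := by
    intro y
    rw [isBlockSeq_iff]
    intro m n hmn
    rcases lt_or_ge n s.length with hn | hn
    · rw [hg1 y n hn, hg1 y m (hmn.trans hn)]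
      exact List.pairwise_iff_getElem.1 hs m n _ _ hmn
    · rw [hg2 y n hn]
      rcases lt_or_ge m s.length with hm | hm
      · rw [hg1 y m hm]
        intro i hi j hj
        have h1 := hd _ (List.getElem_mem hm) i hi
        have h2 := y.le_of_mem_supp _ j hj
        omega
      · rw [hg2 y m hm]
        exact y.2.2 _ _ (by omega)
  refine ⟨fun y => ⟨g y, hgb y⟩, ?_, ?_, fun y => mem_cyl_iff.2 fun i hi => hg1 y i hi,
    fun y i hi => hg2 y i hi⟩
  · refine Continuous.subtype_mk (continuous_pi fun i => ?_) _
    rcases lt_or_ge i s.length with hi | hi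
    · simp only [fun y => hg1 y i hi]
      exact continuous_const
    · simp only [fun y => hg2 y i hi]
      exact continuous_term _
  · intro U hU
    rw [isOpen_iff_mem_nhds]
    rintro _ ⟨y, hy, rfl⟩
    obtain ⟨m, hm⟩ := exists_cyl_pre_subset hU hy
    set θy : BBd b := ⟨g y, hgb y⟩ with hθy
    -- A preimage y' of z is the first |s| + d terms of y followed by z. The extra 1 makes y' agree
    -- with y at the junction too, so that y' is successive there.
    let M := max m (s.length + d + 1)
    filter_upwards [(isOpen_cyl _).mem_nhds (θy.mem_cyl_pre M)] with z hz
    have hzy : ∀ i < M, z.1 i = g y i := fun i hi => by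
      rw [mem_cyl_iff.1 hz i (by rwa [BBd.length_pre]), BBd.getElem_pre]
    let y' : ℕ → RatBlock b := fun i => if i < s.length + d then y.1 i else z.1 (i - d)
    have hy'1 : ∀ i, i < M → y' i = y.1 i := by
      intro i hi
      by_cases h : i < s.length + d
      · exact if_pos h
      · have : y' i = z.1 (i - d) := if_neg h
        rw [this, hzy _ (by omega), hg2 y _ (by omega)]
        exact congrArg y.1 (by omega)
    have hy'2 : ∀ i, s.length + d ≤ i → y' i = z.1 (i - d) := fun i hi => if_neg (not_lt.2 hi)
    have hy'b : IsBlockSeq b fun n => (y' n).1 := by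
      refine isBlockSeq_of_succ fun n => ?_
      rcases lt_or_ge n (s.length + d) with hn | hn
      · rw [hy'1 n (by omega), hy'1 (n + 1) (by omega)]
        exact y.2.2 _ _ n.lt_succ_self
      · rw [hy'2 n hn, hy'2 (n + 1) (by omega)]
        exact z.2.2 _ _ (by omega)
    refine ⟨⟨y', hy'b⟩, hm M (le_max_left _ _) (mem_cyl_iff.2 fun i hi => ?_), ?_⟩
    · rw [BBd.getElem_pre]
      exact hy'1 i (by rwa [BBd.length_pre] at hi)
    · refine Subtype.ext (funext fun i => ?_)
      change g ⟨y', hy'b⟩ i = z.1 i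
      rcases lt_or_ge i s.length with hi | hi
      · rw [hg1 _ i hi, hzy i (by omega), hg1 y i hi]
      · rw [hg2 _ i hi]
        change y' (i + d) = _
        rw [hy'2 _ (by omega), Nat.add_sub_cancel]

/-- Either the space is ergodic, or the elements of a residual set span uniformly isomorphic
spaces. -/
theorem isErgodic_or_exists_residual [CompleteSpace X] (b : SchauderBasis 𝕜 X) :
    IsErgodic 𝕜 X ∨ ∃ K : ℝ, ∃ A ∈ residual (BBd b), ∀ y ∈ A, ∀ z ∈ A,
      BddIso K (closedSpan 𝕜 y.seq) (closedSpan 𝕜 z.seq) := by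
  by_cases hall : ∀ C : ℕ, IsMeagre (Prod.fst '' isoWitness b C)
  · left
    refine isErgodic_of_isMeagre b ((isMeagre_iUnion hall).mono ?_)
    rintro ⟨x, y⟩ hxy
    exact mem_iUnion.2 (exists_mem_image_isoWitness hxy)
  right
  push Not at hall
  obtain ⟨C, hC⟩ := hall
  -- A non-meagre analytic set is comeagre in some nonempty open O; a rectangle U × V inside O is
  -- sliced at a generic x in U.
  obtain ⟨O, hO, ⟨⟨x₀, y₀⟩, hxy⟩, hOE⟩ :=
    (isMeagre_or_comeagre_in_open_of_analyticSet (analyticSet_image_isoWitness b C)).resolve_left hC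
  obtain ⟨U, V, hU, hV, hxU, hyV, hUV⟩ := isOpen_prod_iff.1 hO x₀ y₀ hxy
  obtain ⟨x, hxU, hx⟩ := (dense_of_mem_residual
    (eventually_residual_section hOE)).inter_open_nonempty U hU ⟨x₀, hxU⟩
  have hx' : ∀ᶠ y in residual (BBd b), y ∈ V →
      BddIso C (closedSpan 𝕜 x.seq) (closedSpan 𝕜 y.seq) := by
    have hx2 : ∀ᶠ y in residual (BBd b), (x, y) ∈ (O \ Prod.fst '' isoWitness b C)ᶜ := hx
    filter_upwards [hx2] with y hy hyV
    refine bddIso_of_mem_image_isoWitness (Nat.cast_nonneg C) ?_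
    by_contra hn
    exact hy ⟨hUV (mk_mem_prod hxU hyV), hn⟩
  obtain ⟨m, hm⟩ := exists_cyl_pre_subset hV hyV
  set s := y₀.pre m with hs
  obtain ⟨d, hd⟩ := exists_below s
  obtain ⟨θ, hθc, hθo, hθs, hθd⟩ :=
    exists_openMap_cyl (y₀.pairwise_pre m) (d := d) (hd.mono (Nat.le_add_left d s.length))
  -- From index |s| on, `θ y` agrees with y shifted by d. Comparing them costs K, and restoring the
  -- d dropped terms leads to L; neither constant depends on y.
  obtain ⟨K, hK⟩ := exists_bddIso_of_eventuallyEq b s.length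
  obtain ⟨L, hL⟩ := exists_bddIso_of_shift b (C * K * (C * K)) d
  refine ⟨L, _, tendsto_residual_of_isOpenMap hθc hθo hx', ?_⟩
  have key : ∀ y : BBd b, BddIso C (closedSpan 𝕜 x.seq) (closedSpan 𝕜 (θ y).seq) →
      BddIso (C * K) (closedSpan 𝕜 x.seq) (closedSpan 𝕜 fun n => y.seq (n + d)) := by
    intro y hy
    refine hy.trans (hK _ _ (θ y).isBlockSeq (θ y).norm_seq (y.isBlockSeq.shift d)
      (fun n => y.norm_seq _) fun n hn => congrArg Subtype.val (hθd y n hn))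
  intro y hy z hz
  have h1 := key y (hy (hm m le_rfl (hθs y)))
  have h2 := key z (hz (hm m le_rfl (hθs z)))
  exact hL _ _ y.isBlockSeq y.norm_seq z.isBlockSeq z.norm_seq (h1.symm.trans h2)

theorem closedSpan_smul {y : ℕ → X} {c : ℕ → 𝕜} (hc : ∀ n, c n ≠ 0) :
    closedSpan 𝕜 (fun n => c n • y n) = closedSpan 𝕜 y := by
  refine le_antisymm (closedSpan_le (isClosed_closedSpan _) fun n =>
    Submodule.smul_mem _ _ (mem_closedSpan y n)) (closedSpan_le (isClosed_closedSpan _) fun n => ?_)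
  have := Submodule.smul_mem _ (c n)⁻¹ (mem_closedSpan (𝕜 := 𝕜) (fun n => c n • y n) n)
  rwa [inv_smul_smul₀ (hc n)] at this

/-- Either the space is ergodic, or all block-sequences passing through infinitely many of suitable
finite block-sequences span uniformly isomorphic spaces. -/
theorem isErgodic_or_exists_isSuccessive [CompleteSpace X] (b : SchauderBasis 𝕜 X) :
    IsErgodic 𝕜 X ∨ ∃ K : ℝ, ∃ u : ℕ → List X, IsSuccessive b u ∧ (∀ n, ∀ x ∈ u n, ‖x‖ = 1) ∧
      ∀ y z : ℕ → X, IsBlockSeq b y → IsBlockSeq b z → PassesThroughInf y u →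
        PassesThroughInf z u → BddIso K (closedSpan 𝕜 y) (closedSpan 𝕜 z) := by
  refine (isErgodic_or_exists_residual b).imp_right ?_
  rintro ⟨K, A, hA, hK⟩
  obtain ⟨δ, hδ, H⟩ := exists_perturbation_bound b
  obtain ⟨u, hu, hQ, huA⟩ := exists_isSuccessive_of_residual hA hδ
  have key : ∀ y : ℕ → X, IsBlockSeq b y → PassesThroughInf y u →
      ∃ a ∈ A, BddIso 2 (closedSpan 𝕜 y) (closedSpan 𝕜 a.seq) := by
    intro y hy hyu
    have hy0 : ∀ n, ((‖y n‖⁻¹ : ℝ) : 𝕜) ≠ 0 := fun n => inv_norm_ne_zero (hy.1 n).1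
    let y₁ : ℕ → X := fun n => ((‖y n‖⁻¹ : ℝ) : 𝕜) • y n
    have hy₁s : ∀ n, supp b (y₁ n) = supp b (y n) := fun n => supp_smul (hy0 n) _
    have hy₁n : ∀ n, ‖y₁ n‖ = 1 := fun n => norm_normalize (hy.1 n).1
    have hy₁ : IsBlockSeq b y₁ := by
      refine ⟨fun n => (hy.1 n).smul (hy0 n), fun m n hmn => ?_⟩
      rw [SuppLT, hy₁s, hy₁s]
      exact hy.2 m n hmn
    -- Terms that are already normalized rational blocks are left alone, so the approximating
    -- sequence still passes through the same lists.
    have hap : ∀ n, ∃ q : RatBlock b, supp b q.1 = supp b (y n) ∧ ‖q.1 - y₁ n‖ ≤ δ n ∧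
        (y n ∈ ratBlocks b → q.1 = y n) := by
      intro n
      by_cases h : y n ∈ ratBlocks b
      · refine ⟨⟨y n, h⟩, rfl, ?_, fun _ => rfl⟩
        simp [y₁, norm_of_mem_ratBlocks h, (hδ n).le]
      · obtain ⟨q, hq, hqs, hqn⟩ := exists_ratBlock_near (hy₁.1 n) (hy₁n n) (hδ n)
        exact ⟨⟨q, hq⟩, hqs.trans (hy₁s n), hqn, fun h' => absurd h' h⟩
    choose q hqs hqn hqy using hap
    let y₂ : BBd b := ⟨q, (isBlockSeq_iff q).2 fun m n hmn => by
      rw [Before, SuppLT, hqs, hqs]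
      exact hy.2 m n hmn⟩
    have hy₂ : PassesThroughInf y₂.seq u := by
      refine hyu.mono ?_
      rintro n ⟨m, hm⟩
      refine ⟨m, fun i hi => ?_⟩
      rw [← hm i hi]
      exact hqy _ (by rw [hm i hi]; exact hQ n _ (List.getElem_mem hi))
    obtain ⟨a, ha, hay⟩ := huA y₂ hy₂
    refine ⟨a, ha, ?_⟩
    rw [← closedSpan_smul hy0]
    refine H y₁ a.seq hy₁ hy₁n fun n => ?_
    calc ‖a.seq n - y₁ n‖ = ‖(a.seq n - y₂.seq n) + ((q n).1 - y₁ n)‖ := by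
          congr 1
          change _ = (a.seq n - (q n).1) + ((q n).1 - y₁ n)
          abel
      -- One δ for rational approximation and one for the expansion of A: this is why the
      -- perturbation bound allows 2δ.
      _ ≤ δ n + δ n := (norm_add_le _ _).trans (add_le_add (hay n) (hqn n))
  refine ⟨2 * K * 2, u, hu, fun n x hx => norm_of_mem_ratBlocks (hQ n x hx),
    fun y z hy hz hyu hzu => ?_⟩
  obtain ⟨a, ha, h1⟩ := key y hy hyu
  obtain ⟨a', ha', h2⟩ := key z hz hzu
  exact (h1.trans (hK a ha a' ha')).trans h2.symm

theorem KIsomorphic.mono {K L : ℝ} (h : K ≤ L) {Y Z : Submodule 𝕜 X} (hYZ : KIsomorphic K Y Z) :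
    KIsomorphic L Y Z := by
  obtain ⟨T, hT⟩ := hYZ
  exact ⟨T, hT.trans h⟩

end Dichotomy

end

end ErgodicBanach

theorem mainTheorem4 {𝕜 X : Type*} [RCLike 𝕜] [NormedAddCommGroup X] [NormedSpace 𝕜 X]
    [CompleteSpace X] (b : SchauderBasis 𝕜 X) :
    -- the dichotomy
    (ErgodicBanach.IsErgodic 𝕜 X ∨
      ∃ K : ℝ, 1 ≤ K ∧ ∃ u : ℕ → List X,
        ErgodicBanach.IsSuccessive b u ∧ (∀ n, ∀ x ∈ u n, ‖x‖ = 1) ∧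
        ∀ y z : ℕ → X, ErgodicBanach.IsBlockSeq b y → ErgodicBanach.IsBlockSeq b z →
          ErgodicBanach.PassesThroughInf y u → ErgodicBanach.PassesThroughInf z u →
          ErgodicBanach.KIsomorphic K
            (ErgodicBanach.closedSpan 𝕜 y) (ErgodicBanach.closedSpan 𝕜 z)) ∧
    -- the dichotomy in terms of residual sets
    (ErgodicBanach.IsErgodic 𝕜 X ∨
      ∃ K : ℝ, 1 ≤ K ∧ ∃ A ∈ residual (ErgodicBanach.BBd b), ∀ y ∈ A, ∀ z ∈ A,
        ErgodicBanach.KIsomorphic K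
          (ErgodicBanach.closedSpan 𝕜 y.seq) (ErgodicBanach.closedSpan 𝕜 z.seq)) ∧
    -- residual sets contain, up to `Δ`, all sequences passing through suitable blocks
    (∀ A ∈ residual (ErgodicBanach.BBd b), ∀ Δ : ℕ → ℝ, (∀ n, 0 < Δ n) →
      ∃ u : ℕ → List X, ErgodicBanach.IsSuccessive b u ∧
        (∀ n, ∀ x ∈ u n, x ∈ ErgodicBanach.ratBlocks b) ∧
        ∀ y : ErgodicBanach.BBd b, ErgodicBanach.PassesThroughInf y.seq u →
          y ∈ ErgodicBanach.expansion A Δ) ∧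
    -- conversely, passing through infinitely many given blocks is a residual property
    (∀ u : ℕ → List X, ErgodicBanach.IsSuccessive b u →
      (∀ n, ∀ x ∈ u n, x ∈ ErgodicBanach.ratBlocks b) →
      {y : ErgodicBanach.BBd b | ErgodicBanach.PassesThroughInf y.seq u} ∈
        residual (ErgodicBanach.BBd b)) ∧
    -- characterization of residual isomorphism classes
    (∀ x : ErgodicBanach.BBd b,
      ErgodicBanach.isoClass x ∈ residual (ErgodicBanach.BBd b) ↔
        ∃ u : ℕ → List X, ErgodicBanach.IsSuccessive b u ∧
          (∀ n, ∀ v ∈ u n, v ∈ ErgodicBanach.ratBlocks b) ∧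
          ∀ y : ErgodicBanach.BBd b, ErgodicBanach.PassesThroughInf y.seq u →
            y ∈ ErgodicBanach.isoClass x) := by
  refine ⟨?_, ?_, fun A hA Δ hΔ => ErgodicBanach.exists_isSuccessive_of_residual hA hΔ,
    fun u hu hQ => ErgodicBanach.residual_passesThroughInf hu hQ,
    ErgodicBanach.isoClass_mem_residual_iff⟩
  · refine (ErgodicBanach.isErgodic_or_exists_isSuccessive b).imp_right ?_
    rintro ⟨K, u, hu, hn, H⟩
    -- Both operator norms are at most K, so their product is at most K².
    exact ⟨max 1 (K * K), le_max_left _ _, u, hu, hn, fun y z hy hz hyu hzu =>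
      (H y z hy hz hyu hzu).kIsomorphic.mono (le_max_right _ _)⟩
  · refine (ErgodicBanach.isErgodic_or_exists_residual b).imp_right ?_
    rintro ⟨K, A, hA, H⟩
    exact ⟨max 1 (K * K), le_max_left _ _, A, hA, fun y hy z hz =>
      (H y hy z hz).kIsomorphic.mono (le_max_right _ _)⟩
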